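/- Notation. $\mathbb{D}^k$ is the closed unit disk in $\mathbb{R}^k$. For $N\in\mathbb{N}$, $\mathrm{Conf}_{\{1,\dots,N\}}(M)\subset M^N$ is the space of $N$ distinct ordered points in $M$. $\mathrm{Conf}(\mathbb{R}^d,\mathbb{D}^k)$ is the quotient of $\bigsqcup_n \mathrm{Conf}_{\{1,\dots,n\}}(\mathbb{R}^d)\times(\mathbb{D}^k)^n$ (quotient topology) which identifies two labelled configurations if they agree up to a permutation after all points with label in $\partial\mathbb{D}^k$ are removed; $\mathrm{Conf}(\mathbb{D}^p)$ is the analogous quotient of $\bigsqcup_n\mathrm{Conf}_{\{1,\dots,n\}}(\mathbb{D}^p)$ in which points on $\partial\mathbb{D}^p$ are disregarded. Identifying the interior of $\mathbb{D}^k$ with $\mathbb{R}^k$ by $x\mapsto x/\sqrt{1+|x|^2}$, the collapse maps $\mathbb{R}^3\times\mathbb{D}^1/\mathrm{bdry}\to\mathbb{D}^4/\mathrm{bdry}$ and $\mathbb{R}^1\times\mathbb{D}^3/\mathrm{bdry}\to\mathbb{D}^4/\mathrm{bdry}$ (which are $\mathbb{R}^3\times\mathbb{R}^1\cong\mathbb{R}^4\cong\operatorname{int}\mathbb{D}^4$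 off infinity) induce maps of configuration spaces. The differential 4-Cohomotopy cocycle space of the transversal space $(\mathbb{R}^3)^{\mathrm{cpt}}\wedge(\mathbb{R}^1)_+\cup(\mathbb{R}^3)_+\wedge(\mathbb{R}^1)^{\mathrm{cpt}}$ of $\mathrm{D}6\perp\mathrm{D}8$ intersections is the fiber product $$\mathrm{Fields}\;=\;\mathrm{Conf}(\mathbb{R}^3,\mathbb{D}^1)\times_{\mathrm{Conf}(\mathbb{D}^4)}\mathrm{Conf}(\mathbb{R}^1,\mathbb{D}^3).$$ Let $R$ be a commutative ring (for instance a field), and let $H^\bullet$ be singular cohomology with coefficients in $R$ with its cup product. The algebra of higher observables is $\mathrm{Obs}^\bullet_{\mathrm{D}6\perp\mathrm{D}8}=H^\bullet\big(\bigsqcup_{[c]\in\pi_0(\mathrm{Fields})}\Omega_c\,\mathrm{Fields}\big)$, where $c$ is a chosen base point in each path component. Statement. For every choice of base points $c$ of the path components of $\mathrm{Fields}$ and $b_N\in\mathrm{Conf}_{\{1,\dots,N\}}(\mathbb{R}^3)$, $N\in\mathbb{N}$, there is an isomorphism of graded $R$-algebras $$\Phi:\ \mathrm{Obs}^\bullet_{\mathrm{D}6\perp\mathrm{D}8}\;\xrightarrow{\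 \sim\ }\;\prod_{N\in\mathbb{N}}H^\bullet\big(\Omega_{b_N}\mathrm{Conf}_{\{1,\dots,N\}}(\mathbb{R}^3)\big),$$ where the product is the product of graded rings: in degree $k$ it is $\prod_N H^k$, with componentwise unit and cup product. In every degree $k$, $\Phi$ maps the submodule of those observables whose restriction to all but finitely many components $\Omega_c\,\mathrm{Fields}$ vanishes isomorphically onto the direct sum $\bigoplus_{N\in\mathbb{N}}H^k\big(\Omega_{b_N}\mathrm{Conf}_{\{1,\dots,N\}}(\mathbb{R}^3)\big)$. -/

import Mathlib

open CategoryTheory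

noncomputable section

namespace Cohomotopy

/-! ### Singular cohomology with its cup product -/

section Cohomology

universe u v

/-- The singular simplicial set of `X`. -/
abbrev Sing (X : Type u) [TopologicalSpace X] : SSet.{u} := TopCat.toSSet.obj (TopCat.of X)

/-- The set of singular `n`-simplices of `X`. -/
abbrev Simplices (X : Type u) [TopologicalSpace X] (n : ℕ) : Type u :=
  (Sing X).obj (Opposite.op (SimplexCategory.mk n))

/-- Singular `n`-cochains with coefficients in `R`. -/
abbrev Cochain (R : Type v) (X : Type u) [TopologicalSpace X] (n : ℕ) : Type (max u v) :=
  Simplices X n → R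

variable (R : Type v) [CommRing R] (X : Type u) [TopologicalSpace X]

/-- The coboundary operator: the alternating sum over the faces of a simplex. -/
def coboundary (n : ℕ) : Cochain R X n →ₗ[R] Cochain R X (n + 1) where
  toFun a := fun s => ∑ i : Fin (n + 2), (-1) ^ (i : ℕ) * a ((Sing X).δ i s)
  map_add' a b := by
    funext s
    simp [mul_add, Finset.sum_add_distrib]
  map_smul' r a := by
    funext s
    simp only [Pi.smul_apply, smul_eq_mul, RingHom.id_apply, Finset.mul_sum]
    exact Finset.sum_congr rfl fun i _ => by ring

/-- Singular cocycles. -/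
def cocycles (n : ℕ) : Submodule R (Cochain R X n) := LinearMap.ker (coboundary R X n)

/-- Singular coboundaries; in degree zero there is only the zero cochain. -/
def coboundaries : (n : ℕ) → Submodule R (Cochain R X n)
  | 0 => ⊥
  | n + 1 => LinearMap.range (coboundary R X n)

/-- Singular cohomology `Hⁿ(X; R)`: cocycles modulo coboundaries. -/
abbrev Cohomology (n : ℕ) : Type (max u v) :=
  cocycles R X n ⧸ (coboundaries R X n).comap (cocycles R X n).subtype

/-- The unit of the cohomology ring: the class of the constant cochain `1`. -/
def cohomologyOne : Cohomology R X 0 :=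
  Submodule.Quotient.mk ⟨fun _ => 1, by
    rw [cocycles, LinearMap.mem_ker]
    funext s
    simp [coboundary, Fin.sum_univ_two]⟩

variable {X}

/-- The face of an `n`-simplex spanned by the vertices `j, …, j + l`. -/
def subface {n : ℕ} (j l : ℕ) (h : j + l ≤ n) (s : Simplices X n) : Simplices X l :=
  (Sing X).map (SimplexCategory.subinterval j l h).op s

variable {R}

/-- The cup product of cochains: the first cochain on the front face times the second one on the
back face. -/
def cupCochain {p q n : ℕ} (h : p + q = n) (a : Cochain R X p) (b : Cochain R X q) :
    Cochain R X n :=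
  fun s => a (subface 0 p (by omega) s) * b (subface p q (by omega) s)

lemma map_map_eq {a b c b' : ℕ} (s : Simplices X a)
    (f : SimplexCategory.mk b ⟶ SimplexCategory.mk a)
    (g : SimplexCategory.mk c ⟶ SimplexCategory.mk b)
    (f' : SimplexCategory.mk b' ⟶ SimplexCategory.mk a)
    (g' : SimplexCategory.mk c ⟶ SimplexCategory.mk b')
    (h : ∀ i : Fin (c + 1), f.toOrderHom (g.toOrderHom i) = f'.toOrderHom (g'.toOrderHom i)) :
    (Sing X).map g.op ((Sing X).map f.op s) = (Sing X).map g'.op ((Sing X).map f'.op s) := by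
  have e : g ≫ f = g' ≫ f' := by
    ext i : 3
    exact h i
  rw [← Functor.map_comp_apply, ← Functor.map_comp_apply, ← op_comp, ← op_comp, e]

lemma map_map_eq' {a b c : ℕ} (s : Simplices X a)
    (f : SimplexCategory.mk b ⟶ SimplexCategory.mk a)
    (g : SimplexCategory.mk c ⟶ SimplexCategory.mk b)
    (f' : SimplexCategory.mk c ⟶ SimplexCategory.mk a)
    (h : ∀ i : Fin (c + 1), f.toOrderHom (g.toOrderHom i) = f'.toOrderHom i) :
    (Sing X).map g.op ((Sing X).map f.op s) = (Sing X).map f'.op s := by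
  have e : g ≫ f = f' := by
    ext i : 3
    exact h i
  rw [← Functor.map_comp_apply, ← op_comp, e]

lemma front_face_low {n p : ℕ} (s : Simplices X (n + 1)) (i : Fin (n + 2)) (h : p ≤ n)
    (hi : (i : ℕ) < p + 2) :
    subface 0 p (by omega) ((Sing X).δ i s) =
      (Sing X).δ (⟨i, hi⟩ : Fin (p + 2)) (subface 0 (p + 1) (by omega) s) := by
  refine map_map_eq _ _ _ _ _ fun j => Fin.ext ?_
  change (i.succAbove _ : ℕ) = ((⟨i, hi⟩ : Fin (p + 2)).succAbove j : ℕ) + 0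
  simp only [Fin.succAbove, Fin.lt_def]
  split_ifs <;> simp_all [SimplexCategory.subinterval]
  omega

lemma front_face_high {n p : ℕ} (s : Simplices X (n + 1)) (i : Fin (n + 2)) (h : p ≤ n)
    (hi : p < (i : ℕ)) :
    subface 0 p (by omega) ((Sing X).δ i s) = subface 0 p (by omega) s := by
  refine map_map_eq' _ _ _ _ fun j => Fin.ext ?_
  change (i.succAbove _ : ℕ) = (j : ℕ) + 0
  have := j.2
  simp only [Fin.succAbove, Fin.lt_def]
  split_ifs <;> simp_all [SimplexCategory.subinterval]
  omega

lemma front_face_last {n p : ℕ} (s : Simplices X (n + 1)) (h : p ≤ n) :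
    (Sing X).δ (Fin.last (p + 1)) (subface 0 (p + 1) (by omega) s) =
      subface 0 p (by omega) s := by
  refine map_map_eq' _ _ _ _ fun j => Fin.ext ?_
  change ((Fin.last (p + 1)).succAbove j : ℕ) + 0 = (j : ℕ) + 0
  simp

lemma back_face_low {n p q : ℕ} (s : Simplices X (n + 1)) (i : Fin (n + 2)) (h : p + q = n)
    (hi : (i : ℕ) ≤ p) :
    subface p q (by omega) ((Sing X).δ i s) = subface (p + 1) q (by omega) s := by
  refine map_map_eq' _ _ _ _ fun j => Fin.ext ?_
  change (i.succAbove ⟨j + p, by omega⟩ : ℕ) = (j : ℕ) + (p + 1)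
  simp only [Fin.succAbove, Fin.lt_def, Fin.val_castSucc]
  split_ifs <;> simp only [Fin.val_castSucc, Fin.val_succ] <;> omega

lemma back_face_high {n p q : ℕ} (s : Simplices X (n + 1)) (i : Fin (n + 2)) (h : p + q = n)
    (k : Fin (q + 2)) (hk : (k : ℕ) + p = i) (hi : 0 < (k : ℕ)) :
    subface p q (by omega) ((Sing X).δ i s) =
      (Sing X).δ k (subface p (q + 1) (by omega) s) := by
  refine map_map_eq _ _ _ _ _ fun j => Fin.ext ?_
  change (i.succAbove ⟨j + p, by omega⟩ : ℕ) = (k.succAbove j : ℕ) + p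
  simp only [Fin.succAbove, Fin.lt_def, Fin.val_castSucc]
  split_ifs <;> simp only [Fin.val_castSucc, Fin.val_succ] <;> omega

lemma back_face_first {n p q : ℕ} (s : Simplices X (n + 1)) (h : p + q = n) :
    (Sing X).δ (0 : Fin (q + 2)) (subface p (q + 1) (by omega) s) =
      subface (p + 1) q (by omega) s := by
  refine map_map_eq' _ _ _ _ fun j => Fin.ext ?_
  change ((0 : Fin (q + 2)).succAbove j : ℕ) + p = (j : ℕ) + (p + 1)
  simp
  omega

/-- The Leibniz rule. -/
lemma coboundary_cup {p q n : ℕ} (h : p + q = n) (h1 : p + 1 + q = n + 1)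
    (h2 : p + (q + 1) = n + 1) (a : Cochain R X p) (b : Cochain R X q) :
    coboundary R X n (cupCochain h a b) =
      cupCochain h1 (coboundary R X p a) b +
        (-1 : R) ^ p • cupCochain h2 a (coboundary R X q b) := by
  funext s
  have e : (p + 1) + (q + 1) = n + 2 := by omega
  simp only [coboundary, LinearMap.coe_mk, AddHom.coe_mk, cupCochain, Pi.add_apply,
    Pi.smul_apply, smul_eq_mul]
  rw [← (finCongr e).sum_comp, Fin.sum_univ_add, Fin.sum_univ_castSucc (n := p + 1),
    Fin.sum_univ_succ (n := q + 1)]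
  have t1 : ∀ i : Fin (p + 1),
      (-1 : R) ^ ((finCongr e (Fin.castAdd (q + 1) i) : Fin (n + 2)) : ℕ) *
        (a (subface 0 p (by omega) ((Sing X).δ (finCongr e (Fin.castAdd (q + 1) i)) s)) *
          b (subface p q (by omega) ((Sing X).δ (finCongr e (Fin.castAdd (q + 1) i)) s))) =
      (-1 : R) ^ (i : ℕ) * a ((Sing X).δ i.castSucc (subface 0 (p + 1) (by omega) s)) *
        b (subface (p + 1) q (by omega) s) := by
    intro i
    rw [front_face_low s _ (by omega) (by simp; omega), back_face_low s _ h (by simp; omega),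
      mul_assoc]
    rfl
  have t2 : ∀ i : Fin (q + 1),
      (-1 : R) ^ ((finCongr e (Fin.natAdd (p + 1) i) : Fin (n + 2)) : ℕ) *
        (a (subface 0 p (by omega) ((Sing X).δ (finCongr e (Fin.natAdd (p + 1) i)) s)) *
          b (subface p q (by omega) ((Sing X).δ (finCongr e (Fin.natAdd (p + 1) i)) s))) =
      (-1 : R) ^ p * (a (subface 0 p (by omega) s) *
        ((-1 : R) ^ ((i.succ : Fin (q + 2)) : ℕ) *
          b ((Sing X).δ i.succ (subface p (q + 1) (by omega) s)))) := by
    intro i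
    rw [front_face_high s _ (by omega) (by simp; omega),
      back_face_high s _ h i.succ (by simp; omega) (by simp)]
    have : ((finCongr e (Fin.natAdd (p + 1) i) : Fin (n + 2)) : ℕ) = p + (i.succ : Fin (q + 2)) := by
      simp; omega
    rw [this, pow_add]
    ring
  rw [Finset.sum_congr rfl fun i _ => t1 i, Finset.sum_congr rfl fun i _ => t2 i,
    front_face_last s (by omega), back_face_first s h]
  simp only [Fin.val_castSucc, Fin.val_last, Fin.val_zero, pow_zero, one_mul, pow_succ,
    Finset.mul_sum, Finset.sum_mul, add_mul, mul_add]
  ring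

lemma cup_mem_cocycles {p q n : ℕ} (h : p + q = n) {a : Cochain R X p} {b : Cochain R X q}
    (ha : a ∈ cocycles R X p) (hb : b ∈ cocycles R X q) :
    cupCochain h a b ∈ cocycles R X n := by
  rw [cocycles, LinearMap.mem_ker] at *
  rw [coboundary_cup h (by omega) (by omega), ha, hb]
  funext s
  simp [cupCochain]

lemma cup_mem_left {p q n : ℕ} (h : p + q = n) {a : Cochain R X p} {b : Cochain R X q}
    (ha : a ∈ coboundaries R X p) (hb : b ∈ cocycles R X q) :
    cupCochain h a b ∈ coboundaries R X n := by
  rw [cocycles, LinearMap.mem_ker] at hb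
  cases p with
  | zero =>
    have : a = 0 := ha
    have : cupCochain h a b = 0 := by funext s; simp [cupCochain, this]
    rw [this]; exact Submodule.zero_mem _
  | succ p =>
    obtain ⟨a, rfl⟩ := ha
    obtain rfl : n = p + q + 1 := by omega
    refine ⟨cupCochain rfl a b, ?_⟩
    rw [coboundary_cup rfl h (by omega), hb]
    funext s
    simp [cupCochain]

lemma cup_mem_right {p q n : ℕ} (h : p + q = n) {a : Cochain R X p} {b : Cochain R X q}
    (ha : a ∈ cocycles R X p) (hb : b ∈ coboundaries R X q) :
    cupCochain h a b ∈ coboundaries R X n := by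
  rw [cocycles, LinearMap.mem_ker] at ha
  cases q with
  | zero =>
    have : b = 0 := hb
    have : cupCochain h a b = 0 := by funext s; simp [cupCochain, this]
    rw [this]; exact Submodule.zero_mem _
  | succ q =>
    obtain ⟨b, rfl⟩ := hb
    obtain rfl : n = p + q + 1 := by omega
    refine ⟨(-1 : R) ^ p • cupCochain rfl a b, ?_⟩
    rw [map_smul, coboundary_cup rfl (by omega) h, ha]
    funext s
    simp [cupCochain, ← mul_assoc, ← mul_pow]

variable (R X) in
/-- The cup product on cohomology classes. -/
def cup (p q : ℕ) : Cohomology R X p →ₗ[R] Cohomology R X q →ₗ[R] Cohomology R X (p + q) :=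
  Submodule.liftQ _
    (LinearMap.flip (Submodule.liftQ _
      (LinearMap.flip (LinearMap.mk₂ R
        (fun (a : cocycles R X p) (b : cocycles R X q) =>
          (Submodule.Quotient.mk ⟨cupCochain rfl a.1 b.1, cup_mem_cocycles rfl a.2 b.2⟩ :
            Cohomology R X (p + q)))
        (fun a a' b => congrArg Submodule.Quotient.mk
          (Subtype.ext (funext fun s => by simp [cupCochain, add_mul])))
        (fun r a b => congrArg Submodule.Quotient.mk
          (Subtype.ext (funext fun s => by simp [cupCochain, mul_assoc])))
        (fun a b b' => congrArg Submodule.Quotient.mk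
          (Subtype.ext (funext fun s => by simp [cupCochain, mul_add])))
        (fun r a b => congrArg Submodule.Quotient.mk
          (Subtype.ext (funext fun s => by simp [cupCochain, mul_left_comm])))))
      (fun b hb => LinearMap.ext fun a => (Submodule.Quotient.mk_eq_zero _).2
        (cup_mem_right rfl a.2 hb))))
    (fun a ha => LinearMap.ext fun y => by
      obtain ⟨b, rfl⟩ := Submodule.Quotient.mk_surjective _ y
      exact (Submodule.Quotient.mk_eq_zero _).2 (cup_mem_left rfl ha b.2))

/-- Pullback of cochains along a continuous map. -/
def pullCochain {Y : Type u} [TopologicalSpace Y] (f : C(X, Y)) (n : ℕ) :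
    Cochain R Y n →ₗ[R] Cochain R X n :=
  LinearMap.funLeft R R ((TopCat.toSSet.map (TopCat.ofHom f)).app _)

lemma coboundary_pull {Y : Type u} [TopologicalSpace Y] (f : C(X, Y)) (n : ℕ)
    (a : Cochain R Y n) :
    coboundary R X n (pullCochain f n a) = pullCochain f (n + 1) (coboundary R Y n a) := by
  funext s
  simp only [coboundary, LinearMap.coe_mk, AddHom.coe_mk, pullCochain, LinearMap.funLeft_apply]
  refine Finset.sum_congr rfl fun i _ => congrArg (fun t => (-1) ^ (i : ℕ) * a t) ?_
  exact NatTrans.naturality_apply (TopCat.toSSet.map (TopCat.ofHom f)) (SimplexCategory.δ i).op s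

variable (R) in
/-- Pullback of cohomology classes along a continuous map. -/
def pullback {Y : Type u} [TopologicalSpace Y] (f : C(X, Y)) (n : ℕ) :
    Cohomology R Y n →ₗ[R] Cohomology R X n :=
  Submodule.mapQ _ _
    ((pullCochain f n).restrict (p := cocycles R Y n) (q := cocycles R X n) fun a ha => by
      rw [cocycles, LinearMap.mem_ker] at *
      rw [coboundary_pull, ha, map_zero])
    (by
      intro a ha
      cases n with
      | zero =>
        have h0 : (a : Cochain R Y 0) = 0 := ha
        have : pullCochain f 0 (a : Cochain R Y 0) = 0 := by rw [h0, map_zero]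
        exact this
      | succ n =>
        obtain ⟨c, hc⟩ := ha
        exact ⟨pullCochain f n c, (coboundary_pull f n c).trans (congrArg _ hc)⟩)

end Cohomology

/-! ### Configuration spaces of points -/

section Configurations

/-- The closed unit disk `𝔻ᵏ`. -/
abbrev Disk (k : ℕ) : Type := Metric.closedBall (0 : EuclideanSpace ℝ (Fin k)) 1

/-- The ordered configuration space of `n` distinct points in `M`. -/
abbrev OrdConf (n : ℕ) (M : Type) : Type := {x : Fin n → M // Function.Injective x}

/-- The ordered configuration space of `n` distinct points in `M` with labels in `L`. -/
abbrev OrdLabConf (n : ℕ) (M L : Type) : Type := OrdConf n M × (Fin n → L)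

variable {M L : Type}

/-- The set of labelled points of a configuration that are not at infinity, where `B ⊆ M × L` is
the set of points at infinity. -/
def visible (B : Set (M × L)) (c : Σ n, OrdLabConf n M L) : Set (M × L) :=
  Set.range (fun i => (c.2.1.1 i, c.2.2 i)) \ B

/-- The space of unordered labelled configurations of any number of distinct points of `M` with
labels in `L`, where points at infinity (that is, in `B`) are disregarded: the quotient of the
disjoint union over `n` of the ordered labelled configuration spaces which identifies two
configurations that differ by a permutation and by points at infinity. -/
def Conf (B : Set (M × L)) : Type := Quotient (Setoid.ker (visible B))

instance (B : Set (M × L)) [TopologicalSpace M] [TopologicalSpace L] :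
    TopologicalSpace (Conf B) :=
  inferInstanceAs (TopologicalSpace (Quotient (Setoid.ker (visible B))))

/-- The boundary `ℝᵈ × ∂𝔻ᵏ` of `ℝᵈ × 𝔻ᵏ`. -/
def bdryEuclid (d k : ℕ) : Set (EuclideanSpace ℝ (Fin d) × Disk k) := {z | ‖z.2.1‖ = 1}

/-- The boundary of `𝔻ᵖ × 𝔻⁰`. -/
def bdryDisk (p : ℕ) : Set (Disk p × Disk 0) := {z | ‖z.1.1‖ = 1}

/-- `Conf(ℝᵈ, 𝔻ᵏ)`: points in `ℝᵈ` labelled in `𝔻ᵏ`, which vanish at the boundary of `𝔻ᵏ`. For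
`d ≥ 1`, this is the value of differential `(d + k)`-Cohomotopy on `(ℝᵈ)ᶜᵖᵗ ∧ (ℝᵏ)₊`. -/
abbrev ConfEuclid (d k : ℕ) : Type := Conf (bdryEuclid d k)

/-- `Conf(𝔻ᵖ)`: points in `𝔻ᵖ` which vanish at the boundary. This is the value of
differential `p`-Cohomotopy on `(ℝᵖ)₊`. -/
abbrev ConfDisk (p : ℕ) : Type := Conf (bdryDisk p)

/-- The standard homeomorphism `x ↦ x / √(1 + ‖x‖²)` of `ℝᵖ` onto the interior of `𝔻ᵖ`. -/
def toDisk {p : ℕ} (x : EuclideanSpace ℝ (Fin p)) : Disk p :=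
  ⟨Homeomorph.unitBall x, Metric.ball_subset_closedBall (Homeomorph.unitBall x).2⟩

/-- The inverse of `toDisk` on the interior of `𝔻ᵖ`. -/
def ofDisk {p : ℕ} (y : Disk p) : EuclideanSpace ℝ (Fin p) :=
  OpenPartialHomeomorph.univUnitBall.symm y.1

lemma toDisk_injective {p : ℕ} : Function.Injective (toDisk (p := p)) := fun _ _ h =>
  Homeomorph.unitBall.injective (Subtype.ext (congrArg (fun z : Disk p => z.1) h))

lemma norm_toDisk_ne {p : ℕ} (x : EuclideanSpace ℝ (Fin p)) : ‖(toDisk x).1‖ ≠ 1 :=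
  (mem_ball_zero_iff.1 (Homeomorph.unitBall x).2).ne

lemma ofDisk_injOn {p : ℕ} : Set.InjOn (ofDisk (p := p)) {y | ‖y.1‖ ≠ 1} := by
  intro x hx y hy h
  have mem : ∀ z : Disk p, ‖z.1‖ ≠ 1 →
      z.1 ∈ (OpenPartialHomeomorph.univUnitBall (E := EuclideanSpace ℝ (Fin p))).target :=
    fun z hz => mem_ball_zero_iff.2 (lt_of_le_of_ne (mem_closedBall_zero_iff.1 z.2) hz)
  exact Subtype.ext (OpenPartialHomeomorph.univUnitBall.symm.injOn (mem x hx) (mem y hy) h)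

open Classical in
/-- The indices of the points of a configuration that are not at infinity. -/
def visibleIdx (B : Set (M × L)) (c : Σ n, OrdLabConf n M L) : Finset (Fin c.1) :=
  {i | (c.2.1.1 i, c.2.2 i) ∉ B}

lemma not_mem_bdry (B : Set (M × L)) (c : Σ n, OrdLabConf n M L)
    (j : Fin (visibleIdx B c).card) :
    (c.2.1.1 ((visibleIdx B c).orderEmbOfFin rfl j),
      c.2.2 ((visibleIdx B c).orderEmbOfFin rfl j)) ∉ B := by
  have := (visibleIdx B c).orderEmbOfFin_mem rfl j
  simpa [visibleIdx] using this

/-- The effect on ordered representatives of the map `collapse` below: points in `B` are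
dropped, all other points `z` are sent to `toDisk (φ z)`. -/
def collapseFun {p : ℕ} (B : Set (M × L)) (φ : M × L → EuclideanSpace ℝ (Fin p))
    (hφ : Set.InjOn φ Bᶜ) (c : Σ n, OrdLabConf n M L) : Σ n, OrdLabConf n (Disk p) (Disk 0) :=
  ⟨(visibleIdx B c).card,
    ⟨fun j => toDisk (φ (c.2.1.1 ((visibleIdx B c).orderEmbOfFin rfl j),
        c.2.2 ((visibleIdx B c).orderEmbOfFin rfl j))),
      fun j k h => by
        have := hφ (not_mem_bdry B c j) (not_mem_bdry B c k) (toDisk_injective h)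
        exact (Finset.orderEmbOfFin _ rfl).injective (c.2.1.2 (Prod.ext_iff.1 this).1)⟩,
    fun _ => ⟨0, by simp⟩⟩

lemma visible_collapseFun {p : ℕ} (B : Set (M × L)) (φ : M × L → EuclideanSpace ℝ (Fin p))
    (hφ : Set.InjOn φ Bᶜ) (c : Σ n, OrdLabConf n M L) :
    visible (bdryDisk p) (collapseFun B φ hφ c) =
      (fun z => (toDisk (φ z), ⟨0, by simp⟩)) '' visible B c := by
  ext w
  constructor
  · rintro ⟨⟨j, rfl⟩, -⟩
    exact ⟨_, ⟨⟨_, rfl⟩, not_mem_bdry B c j⟩, rfl⟩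
  · rintro ⟨_, ⟨⟨i, rfl⟩, hi⟩, rfl⟩
    have hi' : i ∈ visibleIdx B c := by simpa [visibleIdx] using hi
    obtain ⟨j, hj⟩ : i ∈ Set.range ((visibleIdx B c).orderEmbOfFin rfl) := by
      rw [Finset.range_orderEmbOfFin]; exact hi'
    refine ⟨⟨j, ?_⟩, fun h => norm_toDisk_ne _ h⟩
    subst hj
    rfl

/-- The map of configuration spaces `Conf(M, L) → Conf(𝔻ᵖ)` induced by the collapse map
`(M × L) / B → 𝔻ᵖ / ∂𝔻ᵖ` that is the chart `φ` followed by `ℝᵖ ≅ int 𝔻ᵖ` outside of `B`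
and sends `B` to infinity. -/
def collapse {p : ℕ} (B : Set (M × L)) (φ : M × L → EuclideanSpace ℝ (Fin p))
    (hφ : Set.InjOn φ Bᶜ) : Conf B → ConfDisk p :=
  Quotient.map (collapseFun B φ hφ) fun c c' h => by
    have h : visible B c = visible B c' := h
    change visible (bdryDisk p) _ = visible (bdryDisk p) _
    rw [visible_collapseFun, visible_collapseFun, h]

/-- The chart `ℝᵈ × int 𝔻ᵏ ≅ ℝᵈ × ℝᵏ = ℝᵈ⁺ᵏ`. -/
def chartLeft (d k : ℕ) (z : EuclideanSpace ℝ (Fin d) × Disk k) :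
    EuclideanSpace ℝ (Fin (d + k)) :=
  EuclideanSpace.finAddEquivProd.symm (z.1, ofDisk z.2)

/-- The chart `ℝᵏ × int 𝔻ᵈ ≅ ℝᵈ × ℝᵏ = ℝᵈ⁺ᵏ`, exchanging the factors. -/
def chartRight (d k : ℕ) (z : EuclideanSpace ℝ (Fin k) × Disk d) :
    EuclideanSpace ℝ (Fin (d + k)) :=
  EuclideanSpace.finAddEquivProd.symm (ofDisk z.2, z.1)

lemma chartLeft_injOn (d k : ℕ) : Set.InjOn (chartLeft d k) (bdryEuclid d k)ᶜ := by
  intro z hz w hw h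
  have := Prod.ext_iff.1 (EuclideanSpace.finAddEquivProd.symm.injective h)
  exact Prod.ext this.1 (ofDisk_injOn hz hw this.2)

lemma chartRight_injOn (d k : ℕ) : Set.InjOn (chartRight d k) (bdryEuclid k d)ᶜ := by
  intro z hz w hw h
  have := Prod.ext_iff.1 (EuclideanSpace.finAddEquivProd.symm.injective h)
  exact Prod.ext this.2 (ofDisk_injOn hz hw this.1)

/-- The cocycle space that differential `(d + k)`-Cohomotopy (for `d, k ≥ 1`) assigns to the union
`(ℝᵈ)ᶜᵖᵗ ∧ (ℝᵏ)₊ ∪ (ℝᵈ)₊ ∧ (ℝᵏ)ᶜᵖᵗ` along `(ℝᵈ⁺ᵏ)₊`: the fiber product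
`Conf(ℝᵈ, 𝔻ᵏ) ×_{Conf(𝔻ᵈ⁺ᵏ)} Conf(ℝᵏ, 𝔻ᵈ)`. -/
abbrev UnionCocycles (d k : ℕ) : Type :=
  {z : ConfEuclid d k × ConfEuclid k d //
    collapse (bdryEuclid d k) (chartLeft d k) (chartLeft_injOn d k) z.1 =
      collapse (bdryEuclid k d) (chartRight d k) (chartRight_injOn d k) z.2}

/-- The differential 4-Cohomotopy cocycle space of the transversal space
`(ℝ³)ᶜᵖᵗ ∧ (ℝ¹)₊ ∪ (ℝ³)₊ ∧ (ℝ¹)ᶜᵖᵗ` of D6⊥D8 brane intersections. -/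
abbrev Fields : Type := UnionCocycles 3 1

end Configurations

/-! ### Higher observables -/

section Observables

/-- The based loop space of `X` at `x`, with the compact-open topology. -/
abbrev Loops (X : Type) [TopologicalSpace X] (x : X) : Type := Path x x

/-- The componentwise based loop space of `X`: the disjoint union over the path components of the
loop spaces at the base points `c`. -/
abbrev Phase (X : Type) [TopologicalSpace X] (c : ZerothHomotopy X → X) : Type :=
  Σ q : ZerothHomotopy X, Loops X (c q)

/-- The inclusion of a component loop space. -/
def phaseIncl {X : Type} [TopologicalSpace X] (c : ZerothHomotopy X → X) (q : ZerothHomotopy X) :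
    C(Loops X (c q), Phase X c) where
  toFun l := ⟨q, l⟩
  continuous_toFun := continuous_sigmaMk (σ := fun q => Loops X (c q))

universe v

variable (R : Type v) [CommRing R]

/-- The higher observables of degree `k` on D6⊥D8 configurations. -/
abbrev Obs (c : ZerothHomotopy Fields → Fields) (k : ℕ) : Type v :=
  Cohomology R (Phase Fields c) k

/-- The observables that are supported on finitely many components of the phase space. -/
def finObs (c : ZerothHomotopy Fields → Fields) (k : ℕ) : Submodule R (Obs R c k) where
  carrier := {x | {q | pullback R (phaseIncl c q) k x ≠ 0}.Finite}
  zero_mem' := by simp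
  add_mem' {x y} hx hy := (hx.union hy).subset fun q hq => by
    by_contra h
    simp only [Set.mem_union, Set.mem_ofPred_eq, not_or, not_not] at h
    exact hq (by rw [map_add, h.1, h.2, add_zero])
  smul_mem' r x hx := hx.subset fun q hq h => hq (by rw [map_smul, h, smul_zero])

end Observables

end Cohomotopy

end

open CategoryTheory

noncomputable section

namespace Cohomotopy

/-! ### Functoriality and homotopy invariance of singular cohomology -/

section CohomologyFunctoriality

universe v

variable (R : Type v) [CommRing R] {X Y Z : Type} [TopologicalSpace X] [TopologicalSpace Y]
  [TopologicalSpace Z]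

/-! A cocycle in the fiber product amounts to a finite set of points in `ℝᵈ × ℝ¹` (here `d = 3`):
the two labelled configurations must have the same image in `Conf(𝔻ᵈ⁺¹)`. Membership in the first
factor makes the projections to `ℝᵈ` distinct, membership in the second those to `ℝ¹`. The points
can therefore be listed by increasing coordinate in `ℝ¹`, which turns an unordered configuration
into an ordered one. The coordinates in `ℝ¹` then form a convex space of increasing sequences and
can be moved linearly to a fixed sequence, leaving an ordered configuration in `ℝᵈ`.

The delicate point is the topology, since in each factor alone points may disappear at infinity. In
the first factor this forces the coordinate in `ℝ¹` to infinity over a bounded part of `ℝᵈ`, in the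
second the reverse, and both cannot happen to the same point. The precise form is
`continuous_sum_unionPoints`: summing any continuous function over the points is continuous. The
constant `1` makes the number of points locally constant (`continuous_count`), and bump functions
make the listing continuous (`continuous_listing`).

As `ℝᵈ` with `d > 1` has path connected ordered configuration spaces (`joined_ordConf`), the path
components are indexed by the number `N` of points (`componentCount_bijective`), and the deformation
identifies the loop spaces up to homotopy (`nonempty_loopsEquiv`). Cohomology is homotopy invariant
and takes disjoint unions to products (`pullback_bijective`, `sigma_pullback_bijective`). Each
component of the resulting isomorphism is a pullback along one continuous map, hence multiplicative
and unital, and it detects vanishing on the corresponding path component. -/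

lemma pullback_comp (g : C(Y, Z)) (f : C(X, Y)) (n : ℕ) (x : Cohomology R Z n) :
    pullback R (g.comp f) n x = pullback R f n (pullback R g n x) := by
  obtain ⟨a, rfl⟩ := Submodule.Quotient.mk_surjective _ x
  rfl

lemma pullback_id (n : ℕ) (x : Cohomology R X n) :
    pullback R (ContinuousMap.id X) n x = x := by
  obtain ⟨a, rfl⟩ := Submodule.Quotient.mk_surjective _ x
  rfl

lemma pullback_one (f : C(X, Y)) :
    pullback R f 0 (cohomologyOne R Y) = cohomologyOne R X := rfl

lemma pullback_cup (f : C(X, Y)) (p q : ℕ) (x : Cohomology R Y p) (y : Cohomology R Y q) :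
    pullback R f (p + q) (cup R Y p q x y) = cup R X p q (pullback R f p x) (pullback R f q y) := by
  obtain ⟨a, rfl⟩ := Submodule.Quotient.mk_surjective _ x
  obtain ⟨b, rfl⟩ := Submodule.Quotient.mk_surjective _ y
  rfl

/-- The contravariant functor sending a set `S` to the module of functions `S → R`. -/
def functionModule : Type ⥤ (ModuleCat.{v} R)ᵒᵖ where
  obj S := Opposite.op (ModuleCat.of R (S → R))
  map f := (ModuleCat.ofHom (LinearMap.funLeft R R f)).op

/-- Functions on simplices are contravariant, so with values in the opposite category they form a
simplicial object, and its alternating face map complex is the singular cochain complex read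
backwards. This makes simplicial homotopy theory available for cochains. -/
lemma unop_d_functionModule (n : ℕ) :
    ((((AlgebraicTopology.alternatingFaceMapComplex _).obj
      (((SimplicialObject.whiskering _ _).obj (functionModule R)).obj (Sing Y))).d
        (n + 1) n).unop).hom = coboundary R Y n := by
  rw [AlgebraicTopology.alternatingFaceMapComplex_obj_d, AlgebraicTopology.AlternatingFaceMapComplex.objD,
    unop_sum, ModuleCat.hom_sum]
  refine LinearMap.ext fun a => funext fun s => ?_
  have key (φ : Fin (n + 2) → (Cochain R Y n →ₗ[R] Cochain R Y (n + 1))) :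
      (∑ i, φ i) a s = ∑ i, φ i a s :=
    (congrFun (LinearMap.sum_apply Finset.univ φ a) s).trans (Finset.sum_apply s _ _)
  refine (key _).trans ?_
  refine Finset.sum_congr rfl fun i _ => ?_
  rw [unop_zsmul, ModuleCat.hom_zsmul]
  refine (zsmul_eq_mul _ _).trans ?_
  push_cast
  rfl

variable {R}

/-- A homotopy of maps gives a simplicial homotopy of singular sets. Applying `functionModule`
levelwise turns it into a chain homotopy in the opposite category, which is a cochain homotopy. -/
lemma exists_cochain_homotopy {f g : C(X, Y)} (H : f.Homotopy g) :
    ∃ P : ∀ n, Cochain R Y (n + 1) →ₗ[R] Cochain R X n,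
      (∀ a, pullCochain f 0 a = P 0 (coboundary R Y 0 a) + pullCochain g 0 a) ∧
      ∀ n a, pullCochain f (n + 1) a =
        coboundary R X n (P n a) + P (n + 1) (coboundary R Y (n + 1) a) +
          pullCochain g (n + 1) a := by
  let H₁ : TopCat.Homotopy (TopCat.ofHom f) (TopCat.ofHom g) := H
  let K := (H₁.toSSet.toSimplicialObjectHomotopy.whiskerRight (functionModule R)).toChainHomotopy
  refine ⟨fun n => (K.hom n (n + 1)).unop.hom, fun a => ?_, fun n a => ?_⟩
  · have := K.comm 0
    rw [prevD_eq (j' := 1) (w := by simp), dNext_eq_zero _ _ (by simp), zero_add] at this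
    have := congrArg (fun φ => φ.unop.hom a) this
    rw [← unop_d_functionModule]
    exact this
  · have := K.comm (n + 1)
    rw [dNext_eq (i' := n) (w := by simp), prevD_eq (j' := n + 2) (w := by simp)] at this
    have := congrArg (fun φ => φ.unop.hom a) this
    rw [← unop_d_functionModule, ← unop_d_functionModule]
    exact this

lemma pullback_eq_of_homotopic {f g : C(X, Y)} (H : f.Homotopic g) (n : ℕ)
    (x : Cohomology R Y n) : pullback R f n x = pullback R g n x := by
  obtain ⟨P, h0, h1⟩ := exists_cochain_homotopy (R := R) H.some
  obtain ⟨⟨a, ha⟩, rfl⟩ := Submodule.Quotient.mk_surjective _ x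
  rw [cocycles, LinearMap.mem_ker] at ha
  refine (Submodule.Quotient.eq _).2 ?_
  rw [Submodule.mem_comap]
  change pullCochain f n a - pullCochain g n a ∈ coboundaries R X n
  cases n with
  | zero => rw [h0, ha, map_zero, zero_add, sub_self]; exact Submodule.zero_mem _
  | succ n => rw [h1, ha, map_zero, add_zero, add_sub_cancel_right]; exact ⟨_, rfl⟩

lemma pullback_bijective (e : ContinuousMap.HomotopyEquiv X Y) (n : ℕ) :
    Function.Bijective (pullback R e.toFun n) := by
  refine Function.bijective_iff_has_inverse.2 ⟨pullback R e.invFun n, fun x => ?_, fun x => ?_⟩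
  · rw [← pullback_comp, pullback_eq_of_homotopic e.right_inv, pullback_id]
  · rw [← pullback_comp, pullback_eq_of_homotopic e.left_inv, pullback_id]

end CohomologyFunctoriality

/-! ### Cohomology of a disjoint union -/

section DisjointUnion

universe v

variable {R : Type v} [CommRing R] {ι : Type} {A : ι → Type} [∀ i, TopologicalSpace (A i)]

/-- The composite of a singular simplex with a continuous map. -/
def pushSimplex {X Y : Type} [TopologicalSpace X] [TopologicalSpace Y] (f : C(X, Y)) (n : ℕ) :
    Simplices X n → Simplices Y n :=
  (TopCat.toSSet.map (TopCat.ofHom f)).app _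

/-- The standard simplex is nonempty, so a simplex determines its summand, and connected, so every
simplex lies in one summand. -/
lemma sigma_pushSimplex_bijective (n : ℕ) :
    Function.Bijective (fun s : Σ i, Simplices (A i) n => pushSimplex (ContinuousMap.sigmaMk s.1) n s.2) := by
  constructor
  · rintro ⟨i, s⟩ ⟨j, t⟩ h
    have h' : ∀ x, (⟨i, s.down.hom x⟩ : Σ i, A i) = ⟨j, t.down.hom x⟩ := fun x =>
      congrArg (fun u : Simplices (Σ i, A i) n => u.down.hom x) h
    obtain ⟨x⟩ : Nonempty (SimplexCategory.toTop.{0}.obj (SimplexCategory.mk n)) := inferInstance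
    obtain rfl : i = j := congrArg Sigma.fst (h' x)
    have : s = t := ULift.down_injective (TopCat.hom_ext (ContinuousMap.ext fun x =>
      eq_of_heq (Sigma.mk.inj (h' x)).2))
    rw [this]
  · intro s
    have : ConnectedSpace (SimplexCategory.toTop.{0}.obj (SimplexCategory.mk n)) := inferInstance
    obtain ⟨i, g, hg⟩ := ContinuousMap.exists_lift_sigma (X := SimplexCategory.toTop.{0}.obj (SimplexCategory.mk n)) s.down.hom
    exact ⟨⟨i, ⟨TopCat.ofHom g⟩⟩, ULift.down_injective (TopCat.hom_ext hg.symm)⟩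

/-- By the bijection on simplices the cochain complex is the product of those of the summands, and
products of modules are exact: cocycles and primitives may be chosen summand by summand and glued,
with no finiteness condition. -/
lemma sigma_pullback_bijective (n : ℕ) :
    Function.Bijective (fun (x : Cohomology R (Σ i, A i) n) i => pullback R (.sigmaMk i) n x) := by
  let σ := fun n => Equiv.ofBijective _ (sigma_pushSimplex_bijective (A := A) n)
  let glue : ∀ n, (∀ i, Cochain R (A i) n) → Cochain R (Σ i, A i) n :=
    fun n a s => a ((σ n).symm s).1 ((σ n).symm s).2
  have pull_glue : ∀ n a i, pullCochain (.sigmaMk i) n (glue n a) = a i := by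
    intro n a i
    funext s
    change a ((σ n).symm (σ n ⟨i, s⟩)).1 ((σ n).symm (σ n ⟨i, s⟩)).2 = a i s
    rw [Equiv.symm_apply_apply]
  have ext : ∀ n (a b : Cochain R (Σ i, A i) n),
      (∀ i, pullCochain (.sigmaMk i) n a = pullCochain (.sigmaMk i) n b) → a = b := by
    intro n a b h
    funext s
    obtain ⟨⟨i, t⟩, rfl⟩ := (σ n).surjective s
    exact congrFun (h i) t
  constructor
  · refine (injective_iff_map_eq_zero
      (LinearMap.pi fun i => pullback R (.sigmaMk i) n).toAddMonoidHom).2 fun x hx => ?_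
    obtain ⟨⟨a, ha⟩, rfl⟩ := Submodule.Quotient.mk_surjective _ x
    have hx : ∀ i, pullCochain (.sigmaMk i) n a ∈ coboundaries R (A i) n := fun i =>
      by
      have := congrFun hx i
      exact (Submodule.Quotient.mk_eq_zero ((coboundaries R (A i) n).comap
        (cocycles R (A i) n).subtype)).1 this
    refine (Submodule.Quotient.mk_eq_zero _).2 ?_
    change a ∈ coboundaries R _ n
    cases n with
    | zero => exact ext 0 a 0 fun i => (hx i).trans (map_zero _).symm
    | succ n =>
      choose c hc using hx
      refine ⟨glue n c, ext _ _ _ fun i => ?_⟩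
      rw [← coboundary_pull, pull_glue, hc]
  · intro y
    choose a ha using fun i => Submodule.Quotient.mk_surjective _ (y i)
    refine ⟨Submodule.Quotient.mk ⟨glue n fun i => (a i).1, ?_⟩, funext fun i => ?_⟩
    · rw [cocycles, LinearMap.mem_ker]
      refine ext _ _ _ fun i => ?_
      rw [← coboundary_pull, map_zero]
      exact (congrArg _ (pull_glue n (fun i => (a i).1) i)).trans (a i).2
    · rw [← ha i]
      exact congrArg Submodule.Quotient.mk (Subtype.ext (pull_glue n (fun i => (a i).1) i))

end DisjointUnion

/-! ### Based loop spaces: change of base point and deformations -/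

section LoopSpaces

open unitInterval

variable {X Y : Type} [TopologicalSpace X] [TopologicalSpace Y]

/-- The map of based loop spaces induced by a pointed continuous map. -/
def loopMap (f : C(X, Y)) {x : X} {y : Y} (h : y = f x) : C(Loops X x, Loops Y y) where
  toFun l := (l.map f.continuous).cast h h
  continuous_toFun := Path.continuous_uncurry_iff.1 (f.continuous.comp
    (Path.continuous_uncurry_iff.2 continuous_id))

/-- The loop at the end point of a path that is obtained from a loop at its starting point. -/
def conjLoop {x y : X} (γ : Path x y) (l : Path x x) : Path y y := (γ.symm.trans l).trans γ

lemma continuous_conjLoop_family {ι : Type*} [TopologicalSpace ι] {a b : ι → X}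
    (γ : ∀ t, Path (a t) (b t)) (hγ : Continuous ↿γ) (l : ∀ t, Path (a t) (a t))
    (hl : Continuous ↿l) : Continuous ↿fun t => conjLoop (γ t) (l t) :=
  Path.trans_continuous_family _
    (Path.trans_continuous_family _ (Path.symm_continuous_family γ hγ) _ hl) _ hγ

lemma continuous_conjLoop {x y : X} (γ : Path x y) : Continuous (conjLoop γ) :=
  Path.continuous_uncurry_iff.1 (continuous_conjLoop_family (fun _ => γ)
    (γ.continuous.comp continuous_snd) id (Path.continuous_uncurry_iff.2 continuous_id))

/-- The end point of `initialPath γ s` equals `x` or `y` only propositionally for `s = 0, 1`; this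
removes the resulting casts. -/
lemma conjLoop_cast {x y z : X} (γ : Path x y) (h : z = y) (l : Path x x) :
    conjLoop (γ.cast rfl h).symm (conjLoop (γ.cast rfl h) l) =
      conjLoop γ.symm (conjLoop γ l) := by
  subst h; rfl

/-- The initial part of a path. -/
def initialPath {x y : X} (γ : Path x y) (s : I) : Path x (γ s) where
  toFun t := γ (s * t)
  source' := by simp
  target' := by simp

/-- Conjugating there and back along the initial piece of `γ` up to time `s` always yields a loop at
`x`. Letting `s` shrink to `0` leaves conjugation by constant paths, which is homotopic to the
identity by the unit laws for concatenation. -/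
lemma homotopic_conjLoop_symm {x y : X} (γ : Path x y) :
    (ContinuousMap.mk _ ((continuous_conjLoop γ.symm).comp (continuous_conjLoop γ))).Homotopic
      (ContinuousMap.id (Path x x)) := by
  let K : C(Path x x, Path x x) :=
    ⟨fun l => conjLoop (Path.refl x) (conjLoop (Path.refl x) l),
      (continuous_conjLoop _).comp (continuous_conjLoop _)⟩
  let r : C(Path x x, Path x x) := ⟨fun l => l.trans (Path.refl x), by fun_prop⟩
  let l : C(Path x x, Path x x) := ⟨fun l => (Path.refl x).trans l, by fun_prop⟩
  have hr : r.Homotopic (ContinuousMap.id _) :=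
    ⟨{ toFun := fun p => Path.delayReflRight p.1 p.2
       continuous_toFun := Path.continuous_delayReflRight
       map_zero_left := Path.delayReflRight_zero
       map_one_left := Path.delayReflRight_one }⟩
  have hl : l.Homotopic (ContinuousMap.id _) :=
    ⟨{ toFun := fun p => Path.delayReflLeft p.1 p.2
       continuous_toFun := Path.continuous_delayReflLeft
       map_zero_left := Path.delayReflLeft_zero
       map_one_left := Path.delayReflLeft_one }⟩
  have hK : K.Homotopic (ContinuousMap.id _) := by
    have e : K = (r.comp l).comp (r.comp l) := by
      ext m t
      simp [K, r, l, conjLoop]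
    rw [e]
    have h : (r.comp l).Homotopic (ContinuousMap.id _) := hr.comp hl
    exact h.comp h
  refine ContinuousMap.Homotopic.trans (ContinuousMap.Homotopic.symm ⟨?_⟩) hK
  refine
    { toFun := fun p => conjLoop (initialPath γ p.1).symm (conjLoop (initialPath γ p.1) p.2)
      continuous_toFun := ?_
      map_zero_left := fun m => ?_
      map_one_left := fun m => ?_ }
  · have h : Continuous ↿fun p : I × Path x x => initialPath γ p.1 := by
      change Continuous fun q : (I × Path x x) × I => γ (q.1.1 * q.2)
      fun_prop
    exact Path.continuous_uncurry_iff.1 (continuous_conjLoop_family _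
      (Path.symm_continuous_family _ h) _ (continuous_conjLoop_family _ h _
        (Path.continuous_uncurry_iff.2 continuous_snd)))
  · have e : initialPath γ 0 = (Path.refl x).cast rfl γ.source := by
      ext t; simp [initialPath]
    change conjLoop (initialPath γ 0).symm (conjLoop (initialPath γ 0) m) = _
    rw [e, conjLoop_cast]
    rfl
  · have e : initialPath γ 1 = γ.cast rfl γ.target := by
      ext t; simp [initialPath]
    change conjLoop (initialPath γ 1).symm (conjLoop (initialPath γ 1) m) = _
    rw [e, conjLoop_cast]
    rfl

/-- The change of the base point of the loop space along a path. -/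
def loopsChangeBase {x y : X} (γ : Path x y) :
    ContinuousMap.HomotopyEquiv (Loops X x) (Loops X y) where
  toFun := ⟨_, continuous_conjLoop γ⟩
  invFun := ⟨_, continuous_conjLoop γ.symm⟩
  left_inv := homotopic_conjLoop_symm γ
  right_inv := by
    have := homotopic_conjLoop_symm γ.symm
    simp only [Path.symm_symm] at this
    exact this

/-- A section of a map which is homotopy inverse to it on a path component, relative to the base
point, induces a homotopy equivalence of loop spaces. -/
def loopsEquivOfSection (p : C(X, Y)) (i : C(Y, X)) {x : X} {y : Y} (hx : x = i y) (hy : y = p x)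
    (hpi : ∀ z, p (i z) = z) (D : C(I × X, X)) (h0 : ∀ z, Joined x z → D (0, z) = z)
    (h1 : ∀ z, D (1, z) = i (p z)) (hD : ∀ s, x = D (s, x)) :
    ContinuousMap.HomotopyEquiv (Loops Y y) (Loops X x) where
  toFun := loopMap i hx
  invFun := loopMap p hy
  left_inv := by
    have : (loopMap p hy).comp (loopMap i hx) = ContinuousMap.id _ := by
      ext l t
      exact hpi _
    rw [this]
  right_inv := ContinuousMap.Homotopic.symm
    ⟨{ toFun := fun q => loopMap (D.comp ⟨fun z => (q.1, z), by fun_prop⟩) (hD q.1) q.2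
       continuous_toFun := Path.continuous_uncurry_iff.1 (by
        have : Continuous ↿fun q : I × Loops X x => q.2 :=
          Path.continuous_uncurry_iff.2 continuous_snd
        exact D.continuous.comp ((continuous_fst.comp continuous_fst).prodMk this))
       map_zero_left := fun l => by
        ext t
        -- Every point of a loop at `x` is joined to `x` along the loop itself, so it suffices that
        -- `D` starts at the identity on the path component of `x`.
        exact h0 _ ((joinedIn_univ.1 (JoinedIn.ofLine (f := fun s => l (Set.projIcc 0 1 zero_le_one (s * t)))
          (by fun_prop) (by simp) (by simp) (by simp))))
       map_one_left := fun l => by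
        ext t
        exact h1 _ }⟩

end LoopSpaces

/-! ### Configurations as finite sets of visible points -/

section Points

variable {M L : Type}

/-- The set of points of a configuration, disregarding the points at infinity. -/
def points {B : Set (M × L)} : Conf B → Set (M × L) := Quotient.lift (visible B) fun _ _ h => h

lemma points_injective {B : Set (M × L)} : Function.Injective (points (B := B)) := by
  rintro ⟨c⟩ ⟨c'⟩ h
  exact Quotient.sound h

lemma notMem_of_mem_points {B : Set (M × L)} {z : Conf B} {w : M × L} (h : w ∈ points z) :
    w ∉ B := by
  obtain ⟨c, rfl⟩ := Quotient.exists_rep z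
  exact h.2

lemma finite_points {B : Set (M × L)} (z : Conf B) : (points z).Finite := by
  obtain ⟨c, rfl⟩ := Quotient.exists_rep z
  exact (Set.finite_range _).subset Set.sdiff_subset

lemma fst_injOn_points {B : Set (M × L)} (z : Conf B) : Set.InjOn Prod.fst (points z) := by
  obtain ⟨c, rfl⟩ := Quotient.exists_rep z
  rintro _ ⟨⟨i, rfl⟩, -⟩ _ ⟨⟨j, rfl⟩, -⟩ h
  obtain rfl : i = j := c.2.1.2 h
  rfl

lemma points_collapse {p : ℕ} {B : Set (M × L)} (φ : M × L → EuclideanSpace ℝ (Fin p))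
    (hφ : Set.InjOn φ Bᶜ) (z : Conf B) :
    points (collapse B φ hφ z) = (fun w => (toDisk (φ w), ⟨0, by simp⟩)) '' points z := by
  obtain ⟨c, rfl⟩ := Quotient.exists_rep z
  exact visible_collapseFun B φ hφ c

variable [TopologicalSpace M] [TopologicalSpace L]

/-- Since `φ` vanishes at infinity, discarded points contribute nothing, so on ordered
representatives the sum is just `∑ i, φ (xᵢ, lᵢ)`. Continuity then descends to the quotient. -/
lemma continuous_sum_points {B : Set (M × L)} {φ : M × L → ℝ} (hc : Continuous φ)
    (hφ : ∀ w ∈ B, φ w = 0) : Continuous fun z : Conf B => ∑ᶠ w ∈ points z, φ w := by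
  refine isQuotientMap_quot_mk.continuous_iff.2 (continuous_sigma fun n => ?_)
  have : (fun c : OrdLabConf n M L => ∑ᶠ w ∈ visible B ⟨n, c⟩, φ w) =
      fun c => ∑ i, φ (c.1.1 i, c.2 i) := by
    funext c
    have hinj : Function.Injective fun i => (c.1.1 i, c.2 i) := fun i j h =>
      c.1.2 (Prod.ext_iff.1 h).1
    rw [← finsum_eq_sum_of_fintype, ← finsum_mem_range hinj]
    refine finsum_mem_inter_support_eq φ _ _ ?_
    ext w
    simp only [visible, Set.mem_inter_iff, Set.mem_sdiff, Function.mem_support]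
    exact ⟨fun h => ⟨h.1.1, h.2⟩, fun h => ⟨⟨h.1, fun hB => h.2 (hφ w hB)⟩, h.2⟩⟩
  change Continuous (fun c : OrdLabConf n M L => ∑ᶠ w ∈ visible B ⟨n, c⟩, φ w)
  rw [this]
  exact continuous_finsetSum _ fun i _ => hc.comp
    (((continuous_apply i).comp (continuous_subtype_val.comp continuous_fst)).prodMk
      ((continuous_apply i).comp continuous_snd))

end Points

/-! ### Extending functions from the open to the closed disk -/

section Disks

variable {p : ℕ}

lemma ofDisk_toDisk (x : EuclideanSpace ℝ (Fin p)) : ofDisk (toDisk x) = x :=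
  OpenPartialHomeomorph.univUnitBall.left_inv (Set.mem_univ x)

lemma toDisk_ofDisk {y : Disk p} (h : ‖y.1‖ ≠ 1) : toDisk (ofDisk y) = y :=
  ofDisk_injOn (norm_toDisk_ne _) h (ofDisk_toDisk _)

lemma continuous_toDisk : Continuous (toDisk (p := p)) :=
  (continuous_subtype_val.comp (Homeomorph.unitBall).continuous).subtype_mk _

lemma norm_sq_lt_one {y : Disk p} (h : ‖y.1‖ ≠ 1) : ‖y.1‖ ^ 2 < 1 := by
  have h1 : ‖y.1‖ < 1 := lt_of_le_of_ne (mem_closedBall_zero_iff.1 y.2) h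
  nlinarith [norm_nonneg y.1]

lemma norm_ofDisk {y : Disk p} (h : ‖y.1‖ ≠ 1) : ‖ofDisk y‖ * √(1 - ‖y.1‖ ^ 2) = ‖y.1‖ := by
  have : 0 < √(1 - ‖y.1‖ ^ 2) := Real.sqrt_pos.2 (by linarith [norm_sq_lt_one h])
  rw [ofDisk, OpenPartialHomeomorph.univUnitBall_symm_apply, norm_smul, norm_inv, Real.norm_eq_abs,
    abs_of_pos this]
  field_simp

lemma continuousAt_ofDisk {y : Disk p} (h : ‖y.1‖ ≠ 1) : ContinuousAt (ofDisk (p := p)) y := by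
  have : √(1 - ‖y.1‖ ^ 2) ≠ 0 := (Real.sqrt_pos.2 (by linarith [norm_sq_lt_one h])).ne'
  change ContinuousAt (fun y : Disk p => (√(1 - ‖y.1‖ ^ 2))⁻¹ • y.1) y
  fun_prop (disch := assumption)

open Classical in
-- Towards the boundary sphere the norm of `ofDisk` tends to infinity and exceeds the locally
-- bounded `g`, so the function is zero on a neighbourhood of the boundary.
lemma continuous_extend_disk {A : Type} [TopologicalSpace A]
    {ψ : A × EuclideanSpace ℝ (Fin p) → ℝ} (hψ : Continuous ψ) {g : A → ℝ} (hg : Continuous g)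
    (h0 : ∀ w, g w.1 < ‖w.2‖ → ψ w = 0) :
    Continuous fun w : A × Disk p => if ‖w.2.1‖ = 1 then 0 else ψ (w.1, ofDisk w.2) := by
  refine continuous_iff_continuousAt.2 fun w => ?_
  by_cases hw : ‖w.2.1‖ = 1
  -- This is `g < ‖ofDisk y‖` with the denominator `√(1 - ‖y‖²)` cleared, so that it makes sense on
  -- the boundary, where it reads `0 < 1`.
  · have ho : IsOpen {w : A × Disk p | g w.1 * √(1 - ‖w.2.1‖ ^ 2) < ‖w.2.1‖} :=
      isOpen_lt (by fun_prop) (by fun_prop)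
    have : ∀ᶠ v in nhds w,
        (0 : ℝ) = if ‖v.2.1‖ = 1 then 0 else ψ (v.1, ofDisk v.2) := by
      filter_upwards [ho.mem_nhds (by simp [hw])] with v hv
      split_ifs with h
      · rfl
      · refine (h0 _ ?_).symm
        have hpos : 0 < √(1 - ‖v.2.1‖ ^ 2) := Real.sqrt_pos.2 (by linarith [norm_sq_lt_one h])
        change _ < _ at hv
        exact lt_of_mul_lt_mul_right (hv.trans_eq (norm_ofDisk h).symm) hpos.le
    exact continuousAt_const.congr this
  · have ho : IsOpen {w : A × Disk p | ‖w.2.1‖ ≠ 1} :=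
      isOpen_ne_fun (by fun_prop) (by fun_prop)
    have : ∀ᶠ v in nhds w,
        ψ (v.1, ofDisk v.2) = if ‖v.2.1‖ = 1 then 0 else ψ (v.1, ofDisk v.2) := by
      filter_upwards [ho.mem_nhds hw] with v hv
      rw [if_neg hv]
    refine ContinuousAt.congr ?_ this
    exact hψ.continuousAt.comp (continuousAt_fst.prodMk
      (ContinuousAt.comp (f := Prod.snd) (continuousAt_ofDisk hw) continuousAt_snd))

end Disks

/-! ### Cocycles as point sets in `ℝᵈ × ℝᵏ`; no point escapes to infinity -/

section UnionPoints

variable {d k : ℕ}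

/-- The set of points in `ℝᵈ × ℝᵏ` of a cocycle. -/
def unionPoints (z : UnionCocycles d k) :
    Set (EuclideanSpace ℝ (Fin d) × EuclideanSpace ℝ (Fin k)) :=
  (fun w => (w.1, ofDisk w.2)) '' points z.1.1

/-- This is the fiber product condition: the images of both configurations in the disk `𝔻ᵈ⁺ᵏ` agree,
and `ℝᵈ × ℝᵏ` embeds there. -/
lemma unionPoints_eq (z : UnionCocycles d k) :
    unionPoints z = (fun w => (ofDisk w.2, w.1)) '' points z.1.2 := by
  have h := congrArg points z.2
  rw [points_collapse, points_collapse] at h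
  have hinj : Function.Injective
      fun w : EuclideanSpace ℝ (Fin d) × EuclideanSpace ℝ (Fin k) =>
        ((toDisk (EuclideanSpace.finAddEquivProd.symm w), ⟨0, by simp⟩) :
          Disk (d + k) × Disk 0) := fun v w e =>
    EuclideanSpace.finAddEquivProd.symm.injective (toDisk_injective (Prod.ext_iff.1 e).1)
  refine hinj.image_injective ?_
  rw [unionPoints, Set.image_image, Set.image_image]
  exact h

lemma points_fst (z : UnionCocycles d k) :
    points z.1.1 = (fun w => (w.1, toDisk w.2)) '' unionPoints z := by
  rw [unionPoints, Set.image_image]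
  refine (Set.image_id _).symm.trans (Set.image_congr fun w hw => ?_)
  rw [toDisk_ofDisk (notMem_of_mem_points hw)]
  rfl

lemma points_snd (z : UnionCocycles d k) :
    points z.1.2 = (fun w => (w.2, toDisk w.1)) '' unionPoints z := by
  rw [unionPoints_eq, Set.image_image]
  refine (Set.image_id _).symm.trans (Set.image_congr fun w hw => ?_)
  rw [toDisk_ofDisk (notMem_of_mem_points hw)]
  rfl

lemma unionPoints_injective : Function.Injective (unionPoints (d := d) (k := k)) := by
  intro z z' h
  refine Subtype.ext (Prod.ext (points_injective ?_) (points_injective ?_))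
  · rw [points_fst, points_fst, h]
  · rw [points_snd, points_snd, h]

lemma finite_unionPoints (z : UnionCocycles d k) : (unionPoints z).Finite :=
  (finite_points _).image _

lemma fst_injOn_unionPoints (z : UnionCocycles d k) : Set.InjOn Prod.fst (unionPoints z) := by
  rintro _ ⟨v, hv, rfl⟩ _ ⟨w, hw, rfl⟩ h
  rw [fst_injOn_points _ hv hw h]

lemma snd_injOn_unionPoints (z : UnionCocycles d k) : Set.InjOn Prod.snd (unionPoints z) := by
  rw [unionPoints_eq]
  rintro _ ⟨v, hv, rfl⟩ _ ⟨w, hw, rfl⟩ h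
  rw [fst_injOn_points _ hv hw h]

/-- A cutoff function, which is `0` where `‖t‖ ≥ ‖x‖ + 1` and `1` where `‖x‖ ≥ ‖t‖`. -/
def cutoff (w : EuclideanSpace ℝ (Fin d) × EuclideanSpace ℝ (Fin k)) : ℝ :=
  max 0 (min 1 (‖w.1‖ + 1 - ‖w.2‖))

/-- Split `ψ` as `cutoff * ψ + (1 - cutoff) * ψ`. The first summand vanishes where `‖t‖` is large
compared with `‖x‖`, so it extends by zero over `ℝᵈ × ∂𝔻ᵏ` and is summed over the first
configuration. The second vanishes where `‖x‖` is large compared with `‖t‖` and is summed over the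
other. No decay of `ψ` is needed. -/
lemma continuous_sum_unionPoints
    {ψ : EuclideanSpace ℝ (Fin d) × EuclideanSpace ℝ (Fin k) → ℝ} (hψ : Continuous ψ) :
    Continuous fun z : UnionCocycles d k => ∑ᶠ w ∈ unionPoints z, ψ w := by
  classical
  have hcut : Continuous (cutoff (d := d) (k := k)) := by unfold cutoff; fun_prop
  have e : ∀ z : UnionCocycles d k, ∑ᶠ w ∈ unionPoints z, ψ w =
      (∑ᶠ w ∈ points z.1.1, if ‖w.2.1‖ = 1 then 0 else
          (fun v => cutoff v * ψ v) (w.1, ofDisk w.2)) +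
        ∑ᶠ w ∈ points z.1.2, if ‖w.2.1‖ = 1 then 0 else
          (fun v => (1 - cutoff v.swap) * ψ v.swap) (w.1, ofDisk w.2) := by
    intro z
    have h1 : Set.InjOn (fun w : EuclideanSpace ℝ (Fin d) × EuclideanSpace ℝ (Fin k) =>
        (w.1, toDisk w.2)) (unionPoints z) := fun v hv w hw h =>
      fst_injOn_unionPoints z hv hw (Prod.ext_iff.1 h).1
    have h2 : Set.InjOn (fun w : EuclideanSpace ℝ (Fin d) × EuclideanSpace ℝ (Fin k) =>
        (w.2, toDisk w.1)) (unionPoints z) := fun v hv w hw h =>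
      snd_injOn_unionPoints z hv hw (Prod.ext_iff.1 h).1
    rw [points_fst, points_snd, finsum_mem_image h1, finsum_mem_image h2,
      ← finsum_mem_add_distrib (finite_unionPoints z)]
    refine finsum_mem_congr rfl fun w _ => ?_
    simp only [if_neg (norm_toDisk_ne _), ofDisk_toDisk, Prod.swap_prod_mk]
    ring
  simp only [e]
  have c1 := continuous_extend_disk (ψ := fun v : EuclideanSpace ℝ (Fin d) ×
    EuclideanSpace ℝ (Fin k) => cutoff v * ψ v) (g := fun x => ‖x‖ + 1)
    (by fun_prop) (by fun_prop) ?_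
  have c2 := continuous_extend_disk (ψ := fun v : EuclideanSpace ℝ (Fin k) ×
    EuclideanSpace ℝ (Fin d) => (1 - cutoff v.swap) * ψ v.swap) (g := fun x => ‖x‖)
    (by fun_prop) (by fun_prop) ?_
  · exact ((continuous_sum_points (B := bdryEuclid d k) c1 fun w hw => if_pos hw).comp
      (continuous_fst.comp continuous_subtype_val)).add
      ((continuous_sum_points (B := bdryEuclid k d) c2 fun w hw => if_pos hw).comp
      (continuous_snd.comp continuous_subtype_val))
  · intro w hw
    have : cutoff w.swap = 1 := by
      rw [cutoff, min_eq_left (by simp only [Prod.fst_swap, Prod.snd_swap]; linarith)]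
      simp
    simp [this]
  · intro w hw
    have : cutoff w = 0 := max_eq_left ((min_le_right _ _).trans (by linarith))
    simp [this]

/-- The number of points of a cocycle. -/
def count (z : UnionCocycles d k) : ℕ := (unionPoints z).ncard

lemma continuous_count : Continuous (count (d := d) (k := k)) := by
  have h : Continuous fun z : UnionCocycles d k => ((count z : ℕ) : ℝ) := by
    have := continuous_sum_unionPoints (d := d) (k := k) (ψ := fun _ => 1) continuous_const
    refine this.congr fun z => ?_
    rw [finsum_mem_eq_finite_toFinset_sum _ (finite_unionPoints z), count,
      Set.ncard_eq_toFinset_card _ (finite_unionPoints z)]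
    simp
  exact Nat.isClosedEmbedding_coe_real.isInducing.continuous_iff.2 h

end UnionPoints

/-! ### Listing the points by their coordinate in `ℝ` -/

section Ordering

variable {d N : ℕ}

/-- The configurations of `N` points in `ℝᵈ × ℝ` with distinct coordinates in `ℝᵈ`, listed by
increasing coordinate in `ℝ`. -/
def IsListing (f : Fin N → EuclideanSpace ℝ (Fin d) × EuclideanSpace ℝ (Fin 1)) : Prop :=
  Function.Injective (fun i => (f i).1) ∧ StrictMono fun i => (f i).2 0

lemma IsListing.injective {f : Fin N → EuclideanSpace ℝ (Fin d) × EuclideanSpace ℝ (Fin 1)}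
    (hf : IsListing f) : Function.Injective f := fun _ _ h => hf.1 (congrArg Prod.fst h)

/-- A strictly increasing sequence is determined by its range, and a listed point by its coordinate
in `ℝ`. -/
lemma IsListing.ext {f g : Fin N → EuclideanSpace ℝ (Fin d) × EuclideanSpace ℝ (Fin 1)}
    (hf : IsListing f) (hg : IsListing g) (h : Set.range f = Set.range g) : f = g := by
  have e : (fun i => (f i).2 0) = fun i => (g i).2 0 := by
    refine (StrictMono.range_inj hf.2 hg.2).1 ?_
    have := congrArg (Set.image fun w : EuclideanSpace ℝ (Fin d) × EuclideanSpace ℝ (Fin 1) =>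
      w.2 0) h
    rwa [← Set.range_comp, ← Set.range_comp] at this
  funext i
  obtain ⟨j, hj⟩ : f i ∈ Set.range g := h ▸ Set.mem_range_self i
  have : (g j).2 0 = (g i).2 0 := by rw [hj]; exact congrFun e i
  rw [← hj, hg.2.injective this]

/-- The space of listed configurations. -/
abbrev Listing (d N : ℕ) : Type :=
  {f : Fin N → EuclideanSpace ℝ (Fin d) × EuclideanSpace ℝ (Fin 1) // IsListing f}

lemma snd_ext {t s : EuclideanSpace ℝ (Fin 1)} (h : t 0 = s 0) : t = s := by
  ext i
  rw [Subsingleton.elim i 0, h]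

lemma exists_listing (z : UnionCocycles d 1) :
    ∃ f : Listing d (count z), Set.range f.1 = unionPoints z := by
  classical
  have hfin := finite_unionPoints z
  let τ : EuclideanSpace ℝ (Fin d) × EuclideanSpace ℝ (Fin 1) → ℝ := fun w => w.2 0
  have hτ : Set.InjOn τ (unionPoints z) := fun v hv w hw h =>
    snd_injOn_unionPoints z hv hw (snd_ext h)
  have hcard : (hfin.toFinset.image τ).card = count z := by
    rw [Finset.card_image_of_injOn (by simpa using hτ), count, Set.ncard_eq_toFinset_card _ hfin]
  let t := (hfin.toFinset.image τ).orderEmbOfFin hcard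
  have ht : Set.range t = τ '' unionPoints z := by
    rw [Finset.range_orderEmbOfFin]; simp
  have hmem : ∀ i, ∃ w ∈ unionPoints z, τ w = t i := fun i => by
    have : t i ∈ Set.range t := ⟨i, rfl⟩
    rwa [ht] at this
  choose f hf hft using hmem
  have hfl : IsListing f := by
    refine ⟨fun i j h => t.injective ?_, fun i j h => ?_⟩
    · rw [← hft, ← hft, fst_injOn_unionPoints z (hf i) (hf j) h]
    · exact ((hft i).trans_lt (t.strictMono h)).trans_eq (hft j).symm
  refine ⟨⟨f, hfl⟩, Set.Subset.antisymm (Set.range_subset_iff.2 hf) fun w hw => ?_⟩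
  obtain ⟨i, hi⟩ : τ w ∈ Set.range t := ht ▸ Set.mem_image_of_mem τ hw
  exact ⟨i, hτ (hf i) hw ((hft i).trans hi)⟩

open Classical in
/-- The listing of the points of a cocycle with `N` points; a default value elsewhere. -/
def listing (f₀ : Listing d N) (z : UnionCocycles d 1) : Listing d N :=
  if h : ∃ f : Listing d N, Set.range f.1 = unionPoints z then h.choose else f₀

lemma range_listing (f₀ : Listing d N) {z : UnionCocycles d 1} (h : count z = N) :
    Set.range (listing f₀ z).1 = unionPoints z := by
  subst h
  rw [listing, dif_pos (exists_listing z)]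
  exact (exists_listing z).choose_spec

lemma count_eq_of_range (f : Listing d N) {z : UnionCocycles d 1}
    (h : Set.range f.1 = unionPoints z) : count z = N := by
  rw [count, ← h, ← Set.image_univ, Set.ncard_image_of_injective _ f.2.injective, Set.ncard_univ,
    Nat.card_fin]

lemma listing_eq (f₀ f : Listing d N) {z : UnionCocycles d 1}
    (h : Set.range f.1 = unionPoints z) : listing f₀ z = f :=
  Subtype.ext ((listing f₀ z).2.ext f.2 ((range_listing f₀ (count_eq_of_range f h)).trans h.symm))

lemma listing_of_count_ne (f₀ : Listing d N) {z : UnionCocycles d 1} (h : count z ≠ N) :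
    listing f₀ z = f₀ :=
  dif_neg fun ⟨f, hf⟩ => h (count_eq_of_range f hf)

lemma isOpen_strictMono_snd : IsOpen
    {f : Fin N → EuclideanSpace ℝ (Fin d) × EuclideanSpace ℝ (Fin 1) |
      StrictMono fun i => (f i).2 0} := by
  have : {f : Fin N → EuclideanSpace ℝ (Fin d) × EuclideanSpace ℝ (Fin 1) |
      StrictMono fun i => (f i).2 0} = ⋂ i, ⋂ j, ⋂ _ : i < j, {f | (f i).2 0 < (f j).2 0} := by
    ext f
    simp [StrictMono]
  rw [this]
  exact isOpen_iInter_of_finite fun i => isOpen_iInter_of_finite fun j =>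
    isOpen_iInter_of_finite fun _ => isOpen_lt (by fun_prop) (by fun_prop)

/-- The set with exactly `N` points is open and closed, and off it the listing is constant. On it,
bump functions at the listed points `p i` show that every nearby cocycle has a point near each `p
i`; these points are still in increasing order, and being `N` in number they are all of its points.
-/
lemma continuous_listing (f₀ : Listing d N) : Continuous (listing f₀) := by
  refine continuous_iff_continuousAt.2 fun z => ?_
  have hcount : ∀ᶠ y in nhds z, count y = count z :=
    (continuous_count.tendsto z).eventually (IsOpen.mem_nhds (isOpen_discrete {count z}) rfl)
  by_cases hz : count z = N
  swap
  · refine continuousAt_const.congr (f := fun _ => f₀) ?_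
    filter_upwards [hcount] with y hy
    exact (listing_of_count_ne f₀ (hy ▸ hz)).symm
  refine Topology.IsInducing.subtypeVal.continuousAt_iff.2 (Metric.continuousAt_iff'.2 fun ε hε => ?_)
  set p := (listing f₀ z).1 with hp
  obtain ⟨δ, hδ, hV⟩ := Metric.isOpen_iff.1 isOpen_strictMono_snd p (listing f₀ z).2.2
  -- Closeness `δ` preserves the strict order of the coordinates in `ℝ`, and `ε` is the required
  -- accuracy.
  let r := min δ ε
  have hr : 0 < r := lt_min hδ hε
  have hpos : ∀ᶠ y in nhds z, ∀ i, 0 < ∑ᶠ w ∈ unionPoints y, max 0 (r - dist w (p i)) := by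
    refine Filter.eventually_all.2 fun i => ?_
    -- At `z` itself the sum is positive because `p i` is one of its points and contributes `r`.
    refine (continuous_sum_unionPoints (by fun_prop)).tendsto z |>.eventually_const_lt ?_
    rw [finsum_mem_eq_finite_toFinset_sum _ (finite_unionPoints z)]
    refine Finset.sum_pos' (fun _ _ => le_max_left _ _) ⟨p i, ?_, ?_⟩
    · rw [Set.Finite.mem_toFinset, ← range_listing f₀ hz]
      exact ⟨i, rfl⟩
    · simpa using hr
  filter_upwards [hcount, hpos] with y hy hy'
  have hex : ∀ i, ∃ w ∈ unionPoints y, dist w (p i) < r := by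
    intro i
    by_contra! h
    refine (hy' i).ne' (finsum_mem_eq_zero_of_forall_eq_zero fun w hw => max_eq_left ?_)
    linarith [h w hw]
  choose w hw hwr using hex
  have hwp : dist w p < r := (dist_pi_lt_iff hr).2 hwr
  have hmono : StrictMono fun i => (w i).2 0 := hV (hwp.trans_le (min_le_left _ _))
  have hinj : Function.Injective w := fun i j h => hmono.injective (by simp [h])
  have hl : IsListing w := ⟨fun i j h => hinj (fst_injOn_unionPoints y (hw i) (hw j) h), hmono⟩
  have hrange : Set.range w = unionPoints y := by
    refine Set.eq_of_subset_of_ncard_le (Set.range_subset_iff.2 hw) ?_ (finite_unionPoints y)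
    rw [← Set.image_univ, Set.ncard_image_of_injective _ hinj, Set.ncard_univ, Nat.card_fin]
    exact (hy.trans hz).le
  have e : (listing f₀ y).1 = w := congrArg Subtype.val (listing_eq f₀ ⟨w, hl⟩ hrange)
  change dist (listing f₀ y).1 p < ε
  rw [e]
  exact hwp.trans_le (min_le_right _ _)

/-- The cocycle with a given listing. -/
def ofListing (f : Listing d N) : UnionCocycles d 1 :=
  ⟨(Quotient.mk _ ⟨N, ⟨fun i => (f.1 i).1, f.2.1⟩, fun i => toDisk (f.1 i).2⟩,
    Quotient.mk _ ⟨N, ⟨fun i => (f.1 i).2, fun i j h => f.2.2.injective (by simp [h])⟩,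
      fun i => toDisk (f.1 i).1⟩), by
    refine points_injective ?_
    rw [points_collapse, points_collapse]
    change _ '' visible _ _ = _ '' visible _ _
    rw [visible, visible, sdiff_eq_left.2, sdiff_eq_left.2,
      ← Set.range_comp, ← Set.range_comp]
    · refine congrArg Set.range (funext fun i => ?_)
      simp [chartLeft, chartRight, ofDisk_toDisk]
    · rw [Set.disjoint_left]
      rintro _ ⟨i, rfl⟩
      exact norm_toDisk_ne _
    · rw [Set.disjoint_left]
      rintro _ ⟨i, rfl⟩
      exact norm_toDisk_ne _⟩

lemma unionPoints_ofListing (f : Listing d N) : unionPoints (ofListing f) = Set.range f.1 := by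
  change _ '' visible _ _ = _
  rw [visible, sdiff_eq_left.2, ← Set.range_comp]
  · refine congrArg Set.range (funext fun i => ?_)
    simp [ofDisk_toDisk]
  · rw [Set.disjoint_left]
    rintro _ ⟨i, rfl⟩
    exact norm_toDisk_ne _

lemma continuous_ofListing : Continuous (ofListing (d := d) (N := N)) := by
  have h (i : Fin N) : Continuous fun f : Listing d N => f.1 i :=
    (continuous_apply i).comp continuous_subtype_val
  refine Continuous.subtype_mk (Continuous.prodMk ?_ ?_) _
  · refine continuous_quot_mk.comp ((continuous_sigmaMk (σ := fun n => OrdLabConf n _ _)).comp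
      (Continuous.prodMk (Continuous.subtype_mk ?_ _) ?_))
    · exact continuous_pi fun i => (h i).fst
    · exact continuous_pi fun i => continuous_toDisk.comp (h i).snd
  · refine continuous_quot_mk.comp ((continuous_sigmaMk (σ := fun n => OrdLabConf n _ _)).comp
      (Continuous.prodMk (Continuous.subtype_mk ?_ _) ?_))
    · exact continuous_pi fun i => (h i).snd
    · exact continuous_pi fun i => continuous_toDisk.comp (h i).fst

lemma count_ofListing (f : Listing d N) : count (ofListing f) = N :=
  count_eq_of_range f (unionPoints_ofListing f).symm

lemma listing_ofListing (f₀ f : Listing d N) : listing f₀ (ofListing f) = f :=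
  listing_eq f₀ f (unionPoints_ofListing f).symm

lemma ofListing_listing (f₀ : Listing d N) {z : UnionCocycles d 1} (h : count z = N) :
    ofListing (listing f₀ z) = z :=
  unionPoints_injective ((unionPoints_ofListing _).trans (range_listing f₀ h))

end Ordering

/-! ### Path connectedness of ordered configuration spaces -/

section Connectedness

variable {N : ℕ} {E : Type} [NormedAddCommGroup E] [NormedSpace ℝ E]

/-- Along the straight segment a collision of the points `i` and `j` at a time `s ≠ 0` would make `z
i - z j` a multiple of `x i - x j`; at `s = 0` the configuration is `x`. -/
lemma joined_of_generic {x z : OrdConf N E}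
    (h : ∀ i j, i ≠ j → z.1 i - z.1 j ∉ Submodule.span ℝ {x.1 i - x.1 j}) : Joined x z := by
  refine JoinedIn.joined (JoinedIn.ofLine (F := Set.univ)
    (f := fun s : ℝ => (⟨fun i => (1 - s) • x.1 i + s • z.1 i, fun i j e => ?_⟩ : OrdConf N E))
    (Continuous.continuousOn (Continuous.subtype_mk (by fun_prop) _)) ?_ ?_ (by simp))
  · by_contra hij
    have e' : (1 - s) • (x.1 i - x.1 j) + s • (z.1 i - z.1 j) = 0 := by
      rw [← sub_eq_zero] at e
      rw [← e]
      module
    by_cases hs : s = 0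
    · simp only [hs, sub_zero, one_smul, zero_smul, add_zero, sub_eq_zero] at e'
      exact hij (x.2 e')
    · refine h i j hij (Submodule.mem_span_singleton.2 ⟨-(s⁻¹ * (1 - s)), ?_⟩)
      have := congrArg (fun v => s⁻¹ • v) e'
      simp only [smul_add, smul_smul, inv_mul_cancel₀ hs, one_smul, smul_zero] at this
      rw [neg_smul]
      exact neg_eq_of_add_eq_zero_right this
  · ext i; simp
  · ext i; simp

/-- Pass through an intermediate `z` that is generic with respect to both `x` and `y`. It exists
because a real vector space is not a finite union of proper subspaces; the subspaces to avoid are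
proper as a line is not all of `E`. -/
lemma joined_ordConf (hE : 1 < Module.finrank ℝ E) (x y : OrdConf N E) : Joined x y := by
  let P : {p : Fin N × Fin N // p.1 ≠ p.2} × Bool → Submodule ℝ (Fin N → E) := fun q =>
    (Submodule.span ℝ {cond q.2 (x.1 q.1.1.1 - x.1 q.1.1.2) (y.1 q.1.1.1 - y.1 q.1.1.2)}).comap
      (LinearMap.proj (R := ℝ) (φ := fun _ => E) q.1.1.1 - LinearMap.proj q.1.1.2)
  have hP : ∀ q, P q ≠ ⊤ := by
    rintro ⟨⟨⟨i, j⟩, hij⟩, u⟩ h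
    let v := cond u (x.1 i - x.1 j) (y.1 i - y.1 j)
    have htop : Submodule.span ℝ {v} = ⊤ := by
      refine eq_top_iff.2 fun w _ => ?_
      -- Placing `w` at index `i` and `0` elsewhere realizes `w` as a difference, so the line would
      -- contain every vector.
      have : Pi.single i w ∈ P ⟨⟨⟨i, j⟩, hij⟩, u⟩ := h ▸ Submodule.mem_top
      simpa [P, v, Pi.single_eq_of_ne (Ne.symm hij)] using this
    refine absurd (finrank_le_one v fun w => Submodule.mem_span_singleton.1 ?_) hE.not_ge
    rw [htop]
    exact Submodule.mem_top
  have hcov : ⋃ q, (P q : Set (Fin N → E)) ≠ Set.univ := fun h => by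
    obtain ⟨q, hq⟩ := Subspace.exists_eq_top_of_iUnion_eq_univ h
    exact hP q hq
  obtain ⟨z, hz⟩ := (Set.ne_univ_iff_exists_notMem _).1 hcov
  simp only [Set.mem_iUnion, SetLike.mem_coe, not_exists] at hz
  have hz1 : ∀ i j, i ≠ j → z i - z j ∉ Submodule.span ℝ {x.1 i - x.1 j} := fun i j hij =>
    hz ⟨⟨⟨i, j⟩, hij⟩, true⟩
  have hz2 : ∀ i j, i ≠ j → z i - z j ∉ Submodule.span ℝ {y.1 i - y.1 j} := fun i j hij =>
    hz ⟨⟨⟨i, j⟩, hij⟩, false⟩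
  have hinj : Function.Injective z := fun i j h => by
    by_contra hij
    exact hz1 i j hij (by rw [h, sub_self]; exact Submodule.zero_mem _)
  exact (joined_of_generic (z := ⟨z, hinj⟩) hz1).trans (joined_of_generic (z := ⟨z, hinj⟩) hz2).symm

end Connectedness

/-! ### Path components of the cocycle space and their loop spaces -/

section Components

open unitInterval

variable {d N : ℕ}

/-- The underlying ordered configuration in `ℝᵈ` of a listing. -/
def fstConf : C(Listing d N, OrdConf N (EuclideanSpace ℝ (Fin d))) where
  toFun f := ⟨fun i => (f.1 i).1, f.2.1⟩
  continuous_toFun := Continuous.subtype_mk (continuous_pi fun i =>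
    ((continuous_apply i).comp continuous_subtype_val).fst) _

/-- The listing with prescribed coordinates in `ℝᵈ` and the coordinates in `ℝ` of `f₀`. -/
def withOrder (f₀ : Listing d N) : C(OrdConf N (EuclideanSpace ℝ (Fin d)), Listing d N) where
  toFun x := ⟨fun i => (x.1 i, (f₀.1 i).2), x.2, f₀.2.2⟩
  continuous_toFun := Continuous.subtype_mk (continuous_pi fun i =>
    ((continuous_apply i).comp continuous_subtype_val).prodMk continuous_const) _

/-- The linear deformation of the coordinates in `ℝ` of a listing to those of `f₀`. -/
def moveOrder (f₀ : Listing d N) : C(I × Listing d N, Listing d N) where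
  toFun p := ⟨fun i => ((p.2.1 i).1, (1 - (p.1 : ℝ)) • (p.2.1 i).2 + (p.1 : ℝ) • (f₀.1 i).2),
    p.2.2.1, fun i j h => by
      have h1 := p.2.2.2 h
      have h2 := f₀.2.2 h
      have h3 := p.1.2.1
      have h4 := p.1.2.2
      simp only [PiLp.add_apply, PiLp.smul_apply, smul_eq_mul] at h1 h2 ⊢
      rcases h3.eq_or_lt with h0 | h0
      · rw [← h0]; linarith
      · exact add_lt_add_of_le_of_lt (mul_le_mul_of_nonneg_left h1.le (by linarith))
          (mul_lt_mul_of_pos_left h2 h0)⟩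
  continuous_toFun := Continuous.subtype_mk (continuous_pi fun i => by
    have h : Continuous fun p : I × Listing d N => p.2.1 i :=
      (continuous_apply i).comp (continuous_subtype_val.comp continuous_snd)
    exact h.fst.prodMk (by fun_prop)) _

lemma moveOrder_zero (f₀ f : Listing d N) : moveOrder f₀ (0, f) = f := by
  refine Subtype.ext (funext fun i => Prod.ext rfl ?_)
  simp [moveOrder]

lemma moveOrder_one (f₀ f : Listing d N) : moveOrder f₀ (1, f) = withOrder f₀ (fstConf f) := by
  refine Subtype.ext (funext fun i => Prod.ext rfl ?_)
  simp [moveOrder, withOrder]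

lemma moveOrder_self (f₀ : Listing d N) (s : I) : moveOrder f₀ (s, f₀) = f₀ := by
  refine Subtype.ext (funext fun i => Prod.ext rfl ?_)
  change (1 - (s : ℝ)) • (f₀.1 i).2 + (s : ℝ) • (f₀.1 i).2 = _
  module

/-- The deformation of the cocycles with `N` points. -/
def moveCocycle (f₀ : Listing d N) : C(I × UnionCocycles d 1, UnionCocycles d 1) where
  toFun p := ofListing (moveOrder f₀ (p.1, listing f₀ p.2))
  continuous_toFun := continuous_ofListing.comp ((moveOrder f₀).continuous.comp
    (continuous_fst.prodMk ((continuous_listing f₀).comp continuous_snd)))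

lemma count_eq_of_joined {z w : UnionCocycles d 1} (h : Joined z w) : count z = count w := by
  obtain ⟨γ⟩ := h
  have := PreconnectedSpace.constant (inferInstance : PreconnectedSpace I)
    (continuous_count.comp γ.continuous) (x := 0) (y := 1)
  simpa using this

lemma joined_moveCocycle_one (f₀ : Listing d N) {z : UnionCocycles d 1} (h : count z = N) :
    Joined z (ofListing (withOrder f₀ (fstConf (listing f₀ z)))) := by
  refine ⟨⟨⟨fun s => moveCocycle f₀ (s, z), by fun_prop⟩, ?_, ?_⟩⟩
  · change ofListing (moveOrder f₀ (0, listing f₀ z)) = z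
    rw [moveOrder_zero, ofListing_listing f₀ h]
  · change ofListing (moveOrder f₀ (1, listing f₀ z)) = _
    rw [moveOrder_one]

/-- Both cocycles deform to the same coordinates in `ℝ`, after which only a path of ordered
configurations in `ℝᵈ` is needed. -/
lemma joined_of_count_eq (hd : 1 < d) {z w : UnionCocycles d 1} (h : count z = count w) :
    Joined z w := by
  obtain ⟨f₀, -⟩ := exists_listing z
  refine (joined_moveCocycle_one f₀ rfl).trans (.trans ?_ (joined_moveCocycle_one f₀ h.symm).symm)
  obtain ⟨γ⟩ := joined_ordConf (by simpa using hd) (fstConf (listing f₀ z)) (fstConf (listing f₀ w))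
  exact ⟨γ.map (continuous_ofListing.comp (withOrder f₀).continuous)⟩

/-- On cocycles with `N` points, forgetting the coordinates in `ℝ` is inverse, up to deformation, to
the section that restores those of a fixed listing. Connectedness moves the base point to `b`. -/
lemma nonempty_loopsEquiv (hd : 1 < d) {z : UnionCocycles d 1} (h : count z = N)
    (b : OrdConf N (EuclideanSpace ℝ (Fin d))) :
    Nonempty (ContinuousMap.HomotopyEquiv (Loops (OrdConf N (EuclideanSpace ℝ (Fin d))) b)
      (Loops (UnionCocycles d 1) z)) := by
  subst h
  -- The reference listing is that of `z` itself, so that the deformation fixes the base point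
  -- throughout.
  obtain ⟨f₀, hf₀⟩ := exists_listing z
  have hl : listing f₀ z = f₀ := listing_eq f₀ f₀ hf₀
  have hz : z = ofListing f₀ := by
    have := ofListing_listing f₀ (z := z) rfl
    rwa [hl, eq_comm] at this
  obtain ⟨γ⟩ := joined_ordConf (by simpa using hd) b (fstConf f₀)
  refine ⟨(loopsChangeBase γ).trans (loopsEquivOfSection
    (fstConf.comp ⟨listing f₀, continuous_listing f₀⟩)
    ((⟨ofListing, continuous_ofListing⟩ : C(Listing d (count z), _)).comp (withOrder f₀))
    (x := z) (y := fstConf f₀) hz (congrArg fstConf hl.symm) (fun x => ?_) (moveCocycle f₀)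
    (fun w hw => ?_) (fun w => ?_) (fun s => ?_))⟩
  · change fstConf (listing f₀ (ofListing (withOrder f₀ x))) = x
    rw [listing_ofListing]
    rfl
  · change ofListing (moveOrder f₀ (0, listing f₀ w)) = w
    rw [moveOrder_zero, ofListing_listing f₀ (count_eq_of_joined hw).symm]
  · change ofListing (moveOrder f₀ (1, listing f₀ w)) = _
    rw [moveOrder_one]
    rfl
  · change z = ofListing (moveOrder f₀ (s, listing f₀ z))
    rw [hl, moveOrder_self, ← hz]

/-- The number of points of the cocycles in a path component. -/
def componentCount : ZerothHomotopy (UnionCocycles d 1) → ℕ :=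
  Quotient.lift count fun _ _ h => count_eq_of_joined h

lemma componentCount_bijective (hd : 1 < d)
    (b : ∀ N : ℕ, OrdConf N (EuclideanSpace ℝ (Fin d))) :
    Function.Bijective (componentCount (d := d)) := by
  constructor
  · rintro ⟨z⟩ ⟨w⟩ h
    exact Quotient.sound (joined_of_count_eq hd h)
  · intro N
    -- The points of `b N` are placed at heights `0, 1, …, N - 1`.
    refine ⟨Quotient.mk _ (ofListing ⟨fun i => ((b N).1 i, EuclideanSpace.single 0 ((i : ℕ) : ℝ)),
      (b N).2, fun i j h => by simpa using h⟩), count_ofListing _⟩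

end Components

/-! ### Assembling the isomorphism of observables -/

section MainTheorem

universe v

variable {R : Type v} [CommRing R]

lemma pi_pullback_bijective {X : Type} [TopologicalSpace X] (c : ZerothHomotopy X → X) {A : ℕ → Type}
    [∀ N, TopologicalSpace (A N)] (σ : ZerothHomotopy X ≃ ℕ)
    (e : ∀ N, ContinuousMap.HomotopyEquiv (A N) (Loops X (c (σ.symm N)))) (k : ℕ) :
    Function.Bijective (LinearMap.pi fun N =>
      pullback R ((phaseIncl c (σ.symm N)).comp (e N).toFun) k) := by
  have h1 := sigma_pullback_bijective (R := R) (A := fun q => Loops X (c q)) k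
  have h2 := (Equiv.piCongrLeft' (fun q => Cohomology R (Loops X (c q)) k) σ).bijective
  have h3 := Function.Bijective.piMap fun N => pullback_bijective (R := R) (e N) k
  have h := h3.comp (h2.comp h1)
  convert h using 1
  funext x N
  exact pullback_comp R (phaseIncl c (σ.symm N)) (e N).toFun k x

lemma mem_range_coeFnLinearMap {M : ℕ → Type v} [∀ N, AddCommMonoid (M N)] [∀ N, Module R (M N)]
    (w : ∀ N, M N) :
    w ∈ LinearMap.range (DirectSum.coeFnLinearMap R (M := M)) ↔ {N | w N ≠ 0}.Finite := by
  classical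
  constructor
  · rintro ⟨x, rfl⟩
    exact DFinsupp.finite_support x
  · intro h
    refine ⟨DirectSum.mk M h.toFinset fun N => w N, ?_⟩
    funext N
    change DFinsupp.mk h.toFinset (fun N => w N) N = w N
    rw [DFinsupp.mk_apply]
    split_ifs with hN
    · rfl
    · simpa using Eq.symm (by simpa using hN)

lemma pullback_comp_ne_zero_iff {X Y Z : Type} [TopologicalSpace X] [TopologicalSpace Y]
    [TopologicalSpace Z] (g : C(Y, Z)) (e : ContinuousMap.HomotopyEquiv X Y) (k : ℕ)
    (x : Cohomology R Z k) :
    pullback R (g.comp e.toFun) k x ≠ 0 ↔ pullback R g k x ≠ 0 := by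
  rw [pullback_comp]
  exact (map_ne_zero_iff (pullback R e.toFun k) (pullback_bijective e k).1)

/-- When `P x q` records that `x` is nonzero on the component `q`, finite support is the same
condition on both sides, since reindexing along a bijection preserves finiteness. -/
lemma map_eq_range_coeFnLinearMap {V : Type v} [AddCommMonoid V] [Module R V] {M : ℕ → Type v}
    [∀ N, AddCommMonoid (M N)] [∀ N, Module R (M N)] (Φ : V ≃ₗ[R] ∀ N, M N) {Q : Type} (σ : Q ≃ ℕ)
    (P : V → Q → Prop) (S : Submodule R V) (hS : ∀ x, x ∈ S ↔ {q | P x q}.Finite)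
    (h : ∀ x N, Φ x N ≠ 0 ↔ P x (σ.symm N)) :
    S.map (Φ : V →ₗ[R] _) = LinearMap.range (DirectSum.coeFnLinearMap R (M := M)) := by
  ext w
  obtain ⟨x, rfl⟩ := Φ.surjective w
  have hmem : Φ x ∈ S.map (Φ : V →ₗ[R] _) ↔ x ∈ S :=
    ⟨fun ⟨_, hy, e⟩ => Φ.injective e ▸ hy, fun hx => ⟨x, hx, rfl⟩⟩
  rw [mem_range_coeFnLinearMap, hmem, hS]
  simp only [h]
  exact ⟨fun hx => Set.Finite.preimage σ.symm.injective.injOn hx,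
    fun hx => Set.Finite.of_preimage hx σ.symm.surjective⟩

variable (R) in
/-- The isomorphism of the cohomology of the disjoint union of the loop spaces with the product of
the cohomologies of homotopy equivalent spaces. -/
def phaseEquiv {X : Type} [TopologicalSpace X] (c : ZerothHomotopy X → X)
    {A : ℕ → Type} [∀ N, TopologicalSpace (A N)] (σ : ZerothHomotopy X ≃ ℕ)
    (e : ∀ N, ContinuousMap.HomotopyEquiv (A N) (Loops X (c (σ.symm N)))) (k : ℕ) :
    Cohomology R (Phase X c) k ≃ₗ[R] (∀ N : ℕ, Cohomology R (A N) k) :=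
  LinearEquiv.ofBijective (LinearMap.pi fun N =>
      pullback R ((phaseIncl c (σ.symm N)).comp (e N).toFun) k)
    (pi_pullback_bijective c σ e k)

lemma phaseEquiv_apply {X : Type} [TopologicalSpace X] (c : ZerothHomotopy X → X)
    {A : ℕ → Type} [∀ N, TopologicalSpace (A N)] (σ : ZerothHomotopy X ≃ ℕ)
    (e : ∀ N, ContinuousMap.HomotopyEquiv (A N) (Loops X (c (σ.symm N)))) (k : ℕ)
    (x : Cohomology R (Phase X c) k) (N : ℕ) :
    phaseEquiv R c σ e k x N = pullback R ((phaseIncl c (σ.symm N)).comp (e N).toFun) k x := rfl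

lemma map_phaseEquiv {X : Type} [TopologicalSpace X] (c : ZerothHomotopy X → X)
    {A : ℕ → Type} [∀ N, TopologicalSpace (A N)] (σ : ZerothHomotopy X ≃ ℕ)
    (e : ∀ N, ContinuousMap.HomotopyEquiv (A N) (Loops X (c (σ.symm N)))) (k : ℕ)
    (S : Submodule R (Cohomology R (Phase X c) k))
    (hS : ∀ x, x ∈ S ↔ {q | pullback R (phaseIncl c q) k x ≠ 0}.Finite) :
    S.map (phaseEquiv R c σ e k : Cohomology R (Phase X c) k →ₗ[R] _) =
        LinearMap.range (DirectSum.coeFnLinearMap R (M := fun N : ℕ => Cohomology R (A N) k)) := by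
  refine map_eq_range_coeFnLinearMap (M := fun N => Cohomology R (A N) k) (phaseEquiv R c σ e k) σ
      (fun x q => pullback R (phaseIncl c q) k x ≠ 0) S hS fun x N => ?_
  rw [phaseEquiv_apply]
  exact pullback_comp_ne_zero_iff (phaseIncl c (σ.symm N)) (e N) k x

lemma exists_phase_equiv {X : Type} [TopologicalSpace X] (c : ZerothHomotopy X → X)
    {A : ℕ → Type} [∀ N, TopologicalSpace (A N)] (σ : ZerothHomotopy X ≃ ℕ)
    (e : ∀ N, ContinuousMap.HomotopyEquiv (A N) (Loops X (c (σ.symm N))))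
    (S : ∀ k, Submodule R (Cohomology R (Phase X c) k))
    (hS : ∀ k x, x ∈ S k ↔ {q | pullback R (phaseIncl c q) k x ≠ 0}.Finite) :
    ∃ Φ : ∀ k : ℕ, Cohomology R (Phase X c) k ≃ₗ[R] (∀ N : ℕ, Cohomology R (A N) k),
      (∀ N, Φ 0 (cohomologyOne R _) N = cohomologyOne R _) ∧
      (∀ (p q : ℕ) (x : Cohomology R (Phase X c) p) (y : Cohomology R (Phase X c) q) (N : ℕ),
        Φ (p + q) (cup R _ p q x y) N = cup R _ p q (Φ p x N) (Φ q y N)) ∧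
      (∀ k : ℕ, (S k).map (Φ k : Cohomology R (Phase X c) k →ₗ[R] _) =
        LinearMap.range (DirectSum.coeFnLinearMap R (M := fun N : ℕ => Cohomology R (A N) k))) :=
  by
  refine ⟨phaseEquiv R c σ e, fun N => ?_, fun p q x y N => ?_, fun k => ?_⟩
  · rw [phaseEquiv_apply, pullback_one]
  · rw [phaseEquiv_apply, phaseEquiv_apply, phaseEquiv_apply, pullback_cup]
  · exact map_phaseEquiv c σ e k (S k) (hS k)

end MainTheorem

end Cohomotopy

end

open Cohomotopy in
theorem mainTheorem4 {R : Type*} [CommRing R]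
    (c : ZerothHomotopy Fields → Fields)
    (hc : ∀ q : ZerothHomotopy Fields, (Quotient.mk _ (c q) : ZerothHomotopy Fields) = q)
    (b : ∀ N : ℕ, OrdConf N (EuclideanSpace ℝ (Fin 3))) :
    ∃ Φ : ∀ k : ℕ, Obs R c k ≃ₗ[R]
        (∀ N : ℕ, Cohomology R (Loops (OrdConf N (EuclideanSpace ℝ (Fin 3))) (b N)) k),
      (∀ N, Φ 0 (cohomologyOne R _) N = cohomologyOne R _) ∧
      (∀ (p q : ℕ) (x : Obs R c p) (y : Obs R c q) (N : ℕ),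
        Φ (p + q) (cup R _ p q x y) N = cup R _ p q (Φ p x N) (Φ q y N)) ∧
      (∀ k : ℕ, (finObs R c k).map (Φ k : Obs R c k →ₗ[R] _) =
        LinearMap.range (DirectSum.coeFnLinearMap R (M := fun N : ℕ =>
          Cohomology R (Loops (OrdConf N (EuclideanSpace ℝ (Fin 3))) (b N)) k))) := by
  have hd : 1 < 3 := by norm_num
  let σ := Equiv.ofBijective _ (componentCount_bijective hd b)
  -- Each base point lies in the component it is chosen for, so it has as many points as the index
  -- of that component.
  have hcount : ∀ N, count (c (σ.symm N)) = N := fun N =>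
    (congrArg componentCount (hc (σ.symm N))).trans (σ.apply_symm_apply N)
  let e := fun N => (nonempty_loopsEquiv hd (hcount N) (b N)).some
  exact exists_phase_equiv c σ e (finObs R c) fun _ _ => Iff.rfl
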